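/- Let $n$ be an even positive integer. Rows below are indexed cyclically by $\mathbb{Z}/n$. **Patterns.** A *pattern* $P$ of length $n$ is a $2\times n$ matrix with $0/1$ entries such that $P(1,i)=1$ implies $P(2,i)=1$. Within a row, a *singleton* is a $1$ with a $0$ on both sides; a *block* is a contiguous sequence of at least three $1$s bounded by a $0$ on both sides; a *run* is a nonempty sequence of blocks and singletons separated by single $0$s, bounded by a $0$ on both sides (a whole cyclic row is a run if, cut at one of its $0$s, the remaining $n-1$ entries are a run); a *nice run* is a run whose blocks all have length exactly $3$. The pattern $P$ is *proper* if: - its second row is a run or consists only of $1$s; in the latter case the first row is a nice run; - above every singleton and above every block of length $3$ of the second row there are only $0$s; - above every block $B$ of length at least $4$ of the second row there is a nice run $R$ and otherwise only $0$s, where the leftmost group of $1$s of $R$ is either a block starting above the 3rd position of $B$ or a singleton above the 2nd or 3rd position of $B$, and symmetrically at the right end. Let $\mu(P)$ be the number of blocks in the first row plus the number of blocks in the second row. For $m\ge 0$ let $G(P;m)$ be the induced subgraph of the cylindrical grid $P_m\times C_n$ (path times cycle) obtained by deleting those vertices $(1,i)$, $(2,i)$ for which $P(1,i)=0$, respectively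 $P(2,i)=0$. Let $Z(P;m)=1-\chi(\mathrm{Ind}(G(P;m)))$, where $\mathrm{Ind}$ is the independence complex and $\chi$ the unreduced Euler characteristic, and let $f_P(t)=\sum_{m\ge0}Z(P;m)t^m$. **Necklaces.** For $k\ge1$, a *$(k,n)$-necklace* consists of $2k$ stones at points of a circle of length $n$, each with a vector in $\{-2,-1,1,2\}$ (positive means clockwise; the stone faces the direction of its vector), such that consecutive stones face opposite directions; consecutive stones facing away from each other are at odd distance; and for consecutive stones facing each other, the distance plus the lengths of the two vectors is odd, the distance is at least $3$, and if it equals $3$ then both vectors have length $1$. Necklaces differing by an isometry of the circle are identified. The transformation $T$ first moves every stone by its vector, then changes the vectors by $-2\to1$, $-1\to2$, $1\to-2$, $2\to-1$, and finally, whenever two stones at distance $3$ face each other, shortens any of their vectors of length $2$ to length $1$. $\mathrm{Neck}(k,n)$ is the directed graph whose vertices are the classes of $(k,n)$-necklaces, with an edge $N\to TN$ for every $(k,n)$-necklace $N$. **Theorem.** Let $P$ be a proper pattern of even length $n$ with $\mu(P)=k$, and for each $1\le i\le k$ let $g_{i,n}$ be any positive common multiple of the lengths of all cycles in $\mathrm{Neck}(i,n)$.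 Then, as formal power series, $$f_P(t)=\frac{h_P(t)}{1-(-1)^{n/2}t^2}\cdot\prod_{i=1}^{k}\frac{1}{1-t^{2g_{i,n}}}$$ for some polynomial $h_P(t)$ with integer coefficients. -/

import Mathlib

namespace HardSquares

/-! ### Independence complexes and the Witten index -/

/-- The independence complex `Ind(G)`: its faces are the nonempty finite independent sets. -/
def indepComplex {V : Type*} (G : SimpleGraph V) : AbstractSimplicialComplex V where
  faces := {s : Finset V | s.Nonempty ∧ G.IsIndepSet (s : Set V)}
  isRelLowerSet_faces := by
    intro s hs
    refine ⟨hs.1, fun t hts ht => ⟨ht, ?_⟩⟩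
    exact hs.2.mono (Finset.coe_subset.mpr hts)
  singleton_mem := by
    intro v
    refine ⟨Finset.singleton_nonempty v, ?_⟩
    rw [Finset.coe_singleton]
    exact Set.pairwise_singleton v _

open Classical in
/-- The unreduced Euler characteristic of a finite simplicial complex: the sum of `(-1)^(dim s)`
over its faces `s`, where `dim s = |s| - 1`. -/
noncomputable def eulerChar {V : Type*} [Fintype V] (K : AbstractSimplicialComplex V) : ℤ :=
  ∑ s ∈ (Finset.univ : Finset (Finset V)) with s ∈ K.faces, (-1) ^ (s.card - 1)

/-- The Witten index `Z(G) = 1 - χ(Ind(G))`. -/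
noncomputable def wittenIndex {V : Type*} [Fintype V] (G : SimpleGraph V) : ℤ :=
  1 - eulerChar (indepComplex G)

/-- The cylindrical grid `P_m × C_n`; the vertices of `C_n` are the residues modulo `n`, and two
distinct residues are adjacent if they differ by `1`. -/
def cylinder (m n : ℕ) : SimpleGraph (Fin m × ZMod n) :=
  (SimpleGraph.pathGraph m).boxProd (SimpleGraph.circulantGraph ({1} : Set (ZMod n)))

/-! ### Structures within a cyclic 0/1 row -/

/-- `l ≥ 1` consecutive entries `1` in positions `i, …, i + l - 1`, bounded by a `0` both on the
left and on the right (in the cyclic sense). -/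
def IsGroup {n : ℕ} (r : ZMod n → Bool) (i : ZMod n) (l : ℕ) : Prop :=
  1 ≤ l ∧ r (i - 1) = false ∧ (∀ j < l, r (i + (j : ZMod n)) = true) ∧
    r (i + (l : ZMod n)) = false

/-- A single `1` with a `0` both on the left and on the right. -/
def IsSingleton {n : ℕ} (r : ZMod n → Bool) (i : ZMod n) : Prop := IsGroup r i 1

/-- A block of length `l` starting in position `i`: at least three consecutive entries `1`, bounded
by zeros. -/
def IsBlock {n : ℕ} (r : ZMod n → Bool) (i : ZMod n) (l : ℕ) : Prop := 3 ≤ l ∧ IsGroup r i l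

/-- The entries in positions `x, …, x + w - 1` are a nonempty run, bounded by a `0` on both sides:
they start and end with a `1`, the `0`s between them are isolated, and each group of `1`s is a
singleton or a block. -/
def IsRun {n : ℕ} (r : ZMod n → Bool) (x : ZMod n) (w : ℕ) : Prop :=
  1 ≤ w ∧ r (x - 1) = false ∧ r x = true ∧
    r (x + (w : ZMod n) - 1) = true ∧ r (x + (w : ZMod n)) = false ∧
    (∀ j : ℕ, j + 1 < w →
      ¬ (r (x + (j : ZMod n)) = false ∧ r (x + ((j + 1 : ℕ) : ZMod n)) = false)) ∧
    ∀ j < w, ∀ l, IsGroup r (x + (j : ZMod n)) l →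
      IsSingleton r (x + (j : ZMod n)) ∨ IsBlock r (x + (j : ZMod n)) l

/-- A run in which every block has length exactly `3`. -/
def IsNiceRun {n : ℕ} (r : ZMod n → Bool) (x : ZMod n) (w : ℕ) : Prop :=
  IsRun r x w ∧ ∀ j < w, ∀ l, IsBlock r (x + (j : ZMod n)) l → l = 3

/-- The whole cyclic row is a run: cut at a suitable `0`, the other `n - 1` entries are a run. -/
def IsWholeRun {n : ℕ} (r : ZMod n → Bool) : Prop := ∃ x w, w + 1 = n ∧ IsRun r x w

/-- The whole cyclic row is a nice run. -/
def IsWholeNiceRun {n : ℕ} (r : ZMod n → Bool) : Prop := ∃ x w, w + 1 = n ∧ IsNiceRun r x w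

/-- The number of blocks in a row, counted by their starting positions. -/
noncomputable def numBlocks {n : ℕ} (r : ZMod n → Bool) : ℕ :=
  {i : ZMod n | ∃ l, IsBlock r i l}.ncard

/-! ### Patterns -/

/-- A pattern of length `n`: a `2 × n` matrix with `0/1` entries such that below each `1` of the
first row there is a `1` in the second row. Columns are indexed cyclically. -/
structure Pattern (n : ℕ) where
  row1 : ZMod n → Bool
  row2 : ZMod n → Bool
  below : ∀ i, row1 i = true → row2 i = true

namespace Pattern

variable {n : ℕ}

/-- The vertices of `P_m × C_n` kept by the pattern, which masks the first two rows of the grid. -/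
def keptVertices (P : Pattern n) (m : ℕ) : Set (Fin m × ZMod n) :=
  {v | (v.1.val = 0 → P.row1 v.2 = true) ∧ (v.1.val = 1 → P.row2 v.2 = true)}

/-- The graph `G(P; m)`. -/
def graph (P : Pattern n) (m : ℕ) : SimpleGraph (P.keptVertices m) :=
  (cylinder m n).induce (P.keptVertices m)

open Classical in
/-- `Z(P; m) = Z(G(P; m))`. -/
noncomputable def Z [NeZero n] (P : Pattern n) (m : ℕ) : ℤ := wittenIndex (P.graph m)

/-- The generating function `f_P(t) = ∑_{m ≥ 0} Z(P; m) t^m`. -/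
noncomputable def genFun [NeZero n] (P : Pattern n) : PowerSeries ℚ :=
  PowerSeries.mk fun m => (P.Z m : ℚ)

/-- The condition on a block of length `l` of the second row that starts in position `s`: above it
there is a nice run, of width `w`, and otherwise only `a` zeros on its left and `b` zeros on its
right. If the leftmost group of the run is a block, then it starts above the 3rd position of the
block below; if it is a singleton, then it is above the 2nd or the 3rd position. The right end is
symmetric. -/
def NiceRunAbove (P : Pattern n) (s : ZMod n) (l : ℕ) : Prop :=
  ∃ a w b : ℕ, l = a + w + b ∧
    IsNiceRun P.row1 (s + (a : ZMod n)) w ∧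
    (∀ j < a, P.row1 (s + (j : ZMod n)) = false) ∧
    (∀ j < b, P.row1 (s + ((a + w + j : ℕ) : ZMod n)) = false) ∧
    (IsBlock P.row1 (s + (a : ZMod n)) 3 → a = 2) ∧
    (IsSingleton P.row1 (s + (a : ZMod n)) → a = 1 ∨ a = 2) ∧
    (IsBlock P.row1 (s + ((a + w : ℕ) : ZMod n) - 3) 3 → b = 2) ∧
    (IsSingleton P.row1 (s + ((a + w : ℕ) : ZMod n) - 1) → b = 1 ∨ b = 2)

/-- Proper patterns. -/
structure IsProper (P : Pattern n) : Prop where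
  second_row : IsWholeRun P.row2 ∨ ∀ i, P.row2 i = true
  full : (∀ i, P.row2 i = true) → IsWholeNiceRun P.row1
  singleton : ∀ i, IsSingleton P.row2 i → P.row1 i = false
  block_three : ∀ s, IsBlock P.row2 s 3 → ∀ j : ℕ, j < 3 → P.row1 (s + (j : ZMod n)) = false
  block_long : ∀ s l, 4 ≤ l → IsBlock P.row2 s l → P.NiceRunAbove s l

/-- The `μ`-invariant: the number of blocks in both rows. -/
noncomputable def mu (P : Pattern n) : ℕ := numBlocks P.row1 + numBlocks P.row2

end Pattern

/-! ### Necklaces -/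

/-- A finite collection of stones with integer stone vectors on a circle of length `n`. A stone is
a pair (position, vector); positive vectors point clockwise. In a necklace all distances between
consecutive stones are integers, so up to a rotation all stones sit at integer points of the
circle, that is, at residues modulo `n`. -/
abbrev Config (n : ℕ) := Finset (ZMod n × ℤ)

/-- The length of the clockwise arc from `x` to `y`. -/
def cwDist {n : ℕ} (x y : ZMod n) : ℕ := (y - x).val

/-- `s` and `t` are consecutive stones, `t` being the next stone clockwise from `s`. -/
def Consecutive {n : ℕ} (S : Config n) (s t : ZMod n × ℤ) : Prop :=
  s ∈ S ∧ t ∈ S ∧ s ≠ t ∧ ∀ u ∈ S, u ≠ s → cwDist s.1 t.1 ≤ cwDist s.1 u.1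

/-- `(k, n)`-necklaces. -/
structure IsNecklace (k n : ℕ) (S : Config n) : Prop where
  card : S.card = 2 * k
  distinct : ∀ s ∈ S, ∀ t ∈ S, s.1 = t.1 → s = t
  vector : ∀ s ∈ S, s.2 = -2 ∨ s.2 = -1 ∨ s.2 = 1 ∨ s.2 = 2
  opposite : ∀ s t, Consecutive S s t → (0 < s.2 ↔ t.2 < 0)
  away : ∀ s t, Consecutive S s t → s.2 < 0 → 0 < t.2 → Odd (cwDist s.1 t.1)
  towards_odd : ∀ s t, Consecutive S s t → 0 < s.2 → t.2 < 0 →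
    Odd (cwDist s.1 t.1 + s.2.natAbs + t.2.natAbs)
  towards_ge : ∀ s t, Consecutive S s t → 0 < s.2 → t.2 < 0 → 3 ≤ cwDist s.1 t.1
  towards_three : ∀ s t, Consecutive S s t → 0 < s.2 → t.2 < 0 → cwDist s.1 t.1 = 3 →
    s.2.natAbs = 1 ∧ t.2.natAbs = 1

/-- The type of `(k, n)`-necklaces. -/
def Necklace (k n : ℕ) := {S : Config n // IsNecklace k n S}

/-- The change of a stone vector in the step TURN. -/
def turn (v : ℤ) : ℤ :=
  if v = -2 then 1 else if v = -1 then 2 else if v = 1 then -2 else if v = 2 then -1 else v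

/-- The steps JUMP and TURN. -/
def jumpTurn {n : ℕ} (S : Config n) : Config n :=
  S.image fun s => (s.1 + (s.2 : ZMod n), turn s.2)

/-- Two stones in distance `3` that face each other (`s` facing clockwise). -/
def FacingAtThree {n : ℕ} (s t : ZMod n × ℤ) : Prop :=
  0 < s.2 ∧ t.2 < 0 ∧ cwDist s.1 t.1 = 3

open Classical in
/-- The step FIX: stones facing each other in distance `3` get vectors of length `1`. -/
noncomputable def fix {n : ℕ} (S : Config n) : Config n :=
  S.image fun s =>
    if ∃ t ∈ S, FacingAtThree s t ∨ FacingAtThree t s then (s.1, s.2.sign) else s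

/-- The necklace transformation `T`. -/
noncomputable def transform {n : ℕ} (S : Config n) : Config n := fix (jumpTurn S)

/-- The isometry `x ↦ ε x + c` of the circle (`ε = 1` or `ε = -1`) acting on stones and on their
vectors. -/
def move {n : ℕ} (ε : ℤˣ) (c : ZMod n) (S : Config n) : Config n :=
  S.image fun s => (((ε : ℤ) : ZMod n) * s.1 + c, (ε : ℤ) * s.2)

theorem move_move {n : ℕ} (ε δ : ℤˣ) (c d : ZMod n) (S : Config n) :
    move δ d (move ε c S) = move (δ * ε) (((δ : ℤ) : ZMod n) * c + d) S := by
  unfold move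
  rw [Finset.image_image]
  congr 1
  funext s
  simp only [Function.comp_apply, Units.val_mul, Int.cast_mul, Prod.mk.injEq]
  constructor <;> ring

theorem move_one_zero {n : ℕ} (S : Config n) : move 1 0 S = S := by
  simp [move]

/-- Two necklaces are isomorphic if they differ by an isometry of the circle. -/
instance necklaceSetoid (k n : ℕ) : Setoid (Necklace k n) where
  r N M := ∃ (ε : ℤˣ) (c : ZMod n), M.1 = move ε c N.1
  iseqv := by
    refine ⟨fun N => ⟨1, 0, (move_one_zero N.1).symm⟩, ?_, ?_⟩
    · rintro N M ⟨ε, c, h⟩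
      refine ⟨ε, -(((ε : ℤ) : ZMod n) * c), ?_⟩
      rw [h, move_move]
      simp [move_one_zero]
    · rintro N M L ⟨ε, c, h⟩ ⟨δ, d, h2⟩
      exact ⟨δ * ε, _, by rw [h2, h, move_move]⟩

/-- Isomorphism classes of `(k, n)`-necklaces. -/
def NecklaceClass (k n : ℕ) := Quotient (necklaceSetoid k n)

/-- The directed graph `Neck(k, n)`: its vertices are the isomorphism classes of
`(k, n)`-necklaces, and there is an edge from the class of `N` to the class of `T N` for each
`(k, n)`-necklace `N`. -/
def neckGraph (k n : ℕ) : Digraph (NecklaceClass k n) where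
  Adj a b := ∃ N M : Necklace k n,
    Quotient.mk _ N = a ∧ Quotient.mk _ M = b ∧ M.1 = transform N.1

/-- `l` is the length of a directed cycle in `D` (a loop is a cycle of length `1`). -/
def IsCycleLength {V : Type*} (D : Digraph V) (l : ℕ) : Prop :=
  1 ≤ l ∧ ∃ c : ℕ → V, (∀ i < l, D.Adj (c i) (c (i + 1))) ∧ c l = c 0 ∧
    Set.InjOn c (Set.Iio l)

end HardSquares

/-!
The proof replaces properness by a local condition, `Admissible`, whose clauses involve at most
five consecutive columns, and follows the Witten indices of admissible patterns as rows of the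
cylinder are folded away.

The Witten index of a graph is the sum of `(-1) ^ |s|` over its independent sets `s`, so it
satisfies the recurrence `signedCount_eq_sub` for deleting a vertex, and closed neighbourhoods of
neighbours of leaves can be removed at the cost of a sign (`signedCount_leaf`). For patterns this
has two consequences.

* If all groups of the first row are singletons (the pattern is *reduced*), then these are leaves,
  and removing them folds the pattern to the pattern `slide` of the next two rows, with one row
  less in the grid: `Pattern.Z_slide`.
* If the first row has a block, then it has length three, and branching at its middle entry gives
  `Z(P) = Z(erase P) - Z(cut P)`, where `erase P` has one block less than `P`, while `cut P` has
  the same number of blocks, but fewer of them in the first row: `Pattern.Z_eq_sub`.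

All these operations preserve admissibility and, except for `erase`, the number of blocks. By
induction on the number of blocks, the patterns `erase P` can be ignored, and it remains to iterate
the map `next` on reduced patterns, which folds the first row and then cuts all blocks of the new
one (`IsAdmissible.genFun_iterate`).

Stones at the ends of the blocks of the second row, whose vectors record how far the run above is,
turn a reduced pattern with `k` blocks into a `(k, n)`-necklace
(`IsAdmissible.isNecklace_stones`). The map `next` becomes the necklace transformation
(`IsAdmissible.transform_stones`): the end of a block moves inwards to the run above it and becomes
the end of a block of the opposite kind in the folded pattern. If `k > 0`, the necklace determines
the pattern (`eq_of_stones_eq`), so patterns with isometric necklaces have the same generating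
function. As there are finitely many patterns, the necklaces eventually run through a cycle of
`Neck(k, n)` (`IsAdmissible.exists_cycle`). If its length is `l`, then a pattern on this cycle
satisfies `f = ± t ^ l * f` up to series with the denominator for `k - 1` blocks, and a factor
`1 - t ^ (2 * g)` with `l ∣ g` makes up for the difference (`HasDenom.of_periodic`). A reduced
pattern without blocks has an alternating row, and folding it twice rotates it by one step, at the
cost of the sign `(-1) ^ (n / 2)`; this gives the remaining factor
(`IsAdmissible.genFun_mem_of_blocks_eq_zero`).
-/

namespace HardSquares

/-! ### A local form of properness -/

/-- The local form of properness, for the two rows `x` (upper) and `y` (lower) of a pattern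
unrolled to `ℤ`. Zeros of the lower row are isolated, and no group in either row has length two.
Above the outer positions of a block of the lower row, and above the middle of a block of length
three, there are zeros; the second position from an end is below a zero or a singleton
(`left_end`, `right_end`). Away from the ends of a block the upper row has no two adjacent zeros,
and the groups of the upper row have at most three entries. Each clause concerns at most five
consecutive columns, so that it can be checked mechanically after local changes of the rows. -/
structure Admissible (x y : ℤ → Bool) : Prop where
  le : ∀ i, x i = true → y i = true
  no_two_zeros : ∀ i, y i = true ∨ y (i + 1) = true
  no_pair : ∀ i, y i = false → y (i + 3) = false → y (i + 1) = true → y (i + 2) = false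
  three : ∀ i, y i = false → y (i + 4) = false → x (i + 2) = false
  next_zero : ∀ i, y i = false → x (i + 1) = false
  prev_zero : ∀ i, y (i + 1) = false → x i = false
  left_end : ∀ i, y i = false → x (i + 2) = true → x (i + 3) = false
  right_end : ∀ i, y (i + 3) = false → x (i + 1) = true → x i = false
  dense : ∀ i, y i = true → y (i + 1) = true → y (i + 2) = true → y (i + 3) = true →
    x (i + 1) = true ∨ x (i + 2) = true
  no_pair_above : ∀ i, x i = false → x (i + 3) = false → x (i + 1) = true → x (i + 2) = false
  no_four : ∀ i, x i = true → x (i + 1) = true → x (i + 2) = true → x (i + 3) = false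

namespace Admissible
variable {x y : ℤ → Bool}

/-- Erasing the middle entries of some blocks of the upper row preserves admissibility. -/
theorem erase (h : Admissible x y) {δ : ℤ → Bool}
    (hδ : ∀ i, δ i = true → x (i - 1) = true ∧ x i = true ∧ x (i + 1) = true) :
    Admissible (fun i => x i && !δ i) y := by
  constructor
  · grind [h.le]
  · exact h.no_two_zeros
  · exact h.no_pair
  · grind [h.three]
  · grind [h.next_zero]
  · grind [h.prev_zero]
  · grind [h.left_end]
  · grind [h.right_end]
  · intro i a b c d
    grind [h.dense i a b c d, hδ (i + 1), hδ (i + 2), h.no_four i, h.no_four (i - 1)]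
  · intro i
    simp only [Bool.and_eq_false_iff, Bool.not_eq_false']
    grind [hδ i, hδ (i + 3), h.no_four i, h.no_four (i - 1), h.no_pair_above i,
      h.no_four (i + 1)]
  · grind [h.no_four]

/-- Erasing some blocks of the upper row, together with the entries below their middles,
preserves admissibility. -/
theorem cut (h : Admissible x y) {δ : ℤ → Bool}
    (hδ : ∀ i, δ i = true → x (i - 1) = true ∧ x i = true ∧ x (i + 1) = true) :
    Admissible (fun i => x i && !δ (i - 1) && !δ i && !δ (i + 1)) (fun i => y i && !δ i) := by
  have far : ∀ i, δ i = true → x (i - 2) = false ∧ x (i + 2) = false ∧ y (i - 3) = true ∧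
      y (i - 2) = true ∧ y (i - 1) = true ∧ y i = true ∧ y (i + 1) = true ∧ y (i + 2) = true ∧
      y (i + 3) = true := by
    intro i hi
    grind [h.no_four (i - 1), h.no_four (i - 2), h.prev_zero (i + 1), h.next_zero (i - 2),
      h.left_end (i - 3), h.right_end i, hδ i hi, h.le i, h.le (i - 1), h.le (i + 1)]
  constructor
  · grind [h.le]
  · intro i
    grind [h.no_two_zeros i, hδ i, hδ (i + 1), far i, far (i + 1)]
  · intro i
    simp only [Bool.and_eq_false_iff, Bool.not_eq_false']
    grind [h.no_pair i, hδ i, hδ (i + 3), far i, far (i + 3)]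
  · intro i
    grind [h.three i, far i, far (i + 4)]
  · intro i
    grind [h.next_zero i]
  · intro i
    grind [h.prev_zero i]
  · intro i
    grind [h.left_end i, far i]
  · intro i
    grind [h.right_end i, far (i + 3)]
  · intro i
    grind [h.dense i, hδ i]
  · intro i
    simp only [Bool.and_eq_false_iff, Bool.not_eq_false']
    grind [h.no_pair_above i, far (i - 1), far (i + 4)]
  · intro i
    grind [h.no_four i]

/-- Folding away an upper row that consists of singletons preserves admissibility: what is left
of the lower row becomes the upper row, and the row below it loses the entries under the
singletons. -/
theorem slide (h : Admissible x y) (hr : ∀ i, x i = true → x (i + 1) = false) :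
    Admissible (fun i => y i && !x (i - 1) && !x i && !x (i + 1)) (fun i => !x i) := by
  constructor
  · grind
  · grind
  · intro i
    grind [h.dense i, h.le i, h.le (i + 3), h.next_zero (i + 2), h.prev_zero i]
  · intro i
    grind [h.dense i, h.le i, h.le (i + 4), h.next_zero (i + 3), h.prev_zero i]
  · grind
  · grind
  · intro i
    grind [h.dense i, h.le i, h.prev_zero i]
  · intro i
    grind [h.dense i, h.le (i + 3), h.next_zero (i + 2)]
  · intro i
    grind [h.no_two_zeros (i + 1)]
  · intro i
    simp only [Bool.and_eq_false_iff, Bool.not_eq_false']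
    grind [h.dense i, h.dense (i + 1), h.dense (i - 1), h.no_pair i, h.le (i - 1), h.le (i + 4)]
  · intro i
    grind [h.dense i]

end Admissible

/-! ### Counting the ends of blocks -/

theorem toNat_eq_add {a b c : Bool} (h : a = true ↔ b = true ∨ c = true)
    (h' : b = true → c = false) : a.toNat = b.toNat + c.toNat := by
  revert a b c; decide

namespace Admissible
variable {x y : ℤ → Bool}

/-- The last entry of a run of singletons lies at distance one or two from the end of the block
below it. -/
theorem toNat_last (h : Admissible x y) (hr : ∀ i, x i = true → x (i + 1) = false) (i : ℤ) :
    (x i && !x (i + 1) && !x (i + 2)).toNat =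
      (x i && !y (i + 2)).toNat + (x i && !x (i + 2) && y (i + 2) && !y (i + 3)).toNat := by
  apply toNat_eq_add
  · grind [h.dense i, hr i, h.le i, h.prev_zero i, h.le (i + 2)]
  · grind

/-- A block of the lower row ends one or two positions after the run of singletons above it, or
it has length three and becomes a block of the upper row of the folded pattern. -/
theorem toNat_right_end (h : Admissible x y)
    {q : ℤ → Bool} (hq : ∀ i, q i = (y i && !x (i - 1) && !x i && !x (i + 1))) (i : ℤ) :
    (y (i + 2) && y (i + 3) && !y (i + 4)).toNat =
      ((x (i + 2) && !y (i + 4)) || (x (i + 1) && !x (i + 3) && y (i + 3) && !y (i + 4))).toNat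
        + (!q i && q (i + 1) && q (i + 2)).toNat := by
  simp only [hq]
  apply toNat_eq_add
  · constructor
    · simp only [Bool.and_eq_true, Bool.not_eq_true', Bool.or_eq_true, Bool.and_eq_false_iff,
        Bool.not_eq_false']
      grind [h.dense i, h.no_pair (i + 1), h.le (i + 3), h.prev_zero (i + 3), h.next_zero i,
        h.le (i + 1), h.le i]
    · simp only [Bool.and_eq_true, Bool.not_eq_true', Bool.or_eq_true, Bool.and_eq_false_iff,
        Bool.not_eq_false']
      grind [h.dense i, h.dense (i - 1), h.dense (i + 1), h.no_pair i, h.le (i - 1), h.le (i + 2),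
        h.prev_zero (i + 2), h.next_zero (i + 2), h.le (i + 1), h.next_zero (i + 1),
        h.prev_zero (i + 1), h.le (i + 3)]
  · grind

end Admissible

namespace Admissible
variable {x y : ℤ → Bool}

theorem toNat_left_end_erase (h : Admissible x y) {δ : ℤ → Bool}
    (hδ : ∀ i, δ i = true → x (i - 1) = true ∧ x i = true ∧ x (i + 1) = true) (i : ℤ) :
    (!x i && x (i + 1) && x (i + 2)).toNat =
      (!(x i && !δ i) && (x (i + 1) && !δ (i + 1)) && (x (i + 2) && !δ (i + 2))).toNat
        + (δ (i + 2)).toNat := by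
  apply toNat_eq_add
  · simp only [Bool.and_eq_true, Bool.not_eq_true', Bool.and_eq_false_iff, Bool.not_eq_false']
    grind [hδ i, hδ (i + 1), hδ (i + 2), h.no_four i, h.no_four (i - 1)]
  · grind

theorem toNat_left_end_cut (h : Admissible x y) {δ : ℤ → Bool}
    (hδ : ∀ i, δ i = true → x (i - 1) = true ∧ x i = true ∧ x (i + 1) = true) (i : ℤ) :
    (!x i && x (i + 1) && x (i + 2)).toNat =
      (!(x i && !δ (i - 1) && !δ i && !δ (i + 1)) &&
        (x (i + 1) && !δ i && !δ (i + 1) && !δ (i + 2)) &&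
        (x (i + 2) && !δ (i + 1) && !δ (i + 2) && !δ (i + 3))).toNat
        + (δ (i + 2)).toNat := by
  apply toNat_eq_add
  · simp only [Bool.and_eq_true, Bool.not_eq_true', Bool.and_eq_false_iff, Bool.not_eq_false']
    grind [hδ (i - 1), hδ i, hδ (i + 1), hδ (i + 2), hδ (i + 3), h.no_four i, h.no_four (i - 1),
      h.no_four (i + 1)]
  · grind

theorem toNat_left_end_cut_below (h : Admissible x y) {δ : ℤ → Bool}
    (hδ : ∀ i, δ i = true → x (i - 1) = true ∧ x i = true ∧ x (i + 1) = true) (i : ℤ) :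
    (!(y i && !δ i) && (y (i + 1) && !δ (i + 1)) && (y (i + 2) && !δ (i + 2))).toNat =
      (!y i && y (i + 1) && y (i + 2)).toNat + (δ i).toNat := by
  apply toNat_eq_add
  · simp only [Bool.and_eq_true, Bool.not_eq_true', Bool.and_eq_false_iff, Bool.not_eq_false']
    grind [hδ i, hδ (i + 1), hδ (i + 2), h.no_four (i - 1), h.no_four i,
      h.no_four (i + 1), h.prev_zero (i + 1), h.next_zero i, h.le i, h.le (i + 1)]
  · grind [h.le i]

end Admissible

/-! ### Operations on patterns -/

theorem forall_zmod_iff {n : ℕ} {p : ZMod n → Prop} : (∀ i, p i) ↔ ∀ j : ℤ, p (j : ZMod n) :=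
  (ZMod.intCast_surjective (n := n)).forall

/-- The number of blocks of a cyclic row whose groups are singletons or blocks: a block is
recognized by the entries `011` at its left end. -/
def leftEnds {n : ℕ} [NeZero n] (r : ZMod n → Bool) : ℕ :=
  ∑ i, (!r i && r (i + 1) && r (i + 2)).toNat

theorem sum_toNat_shift {n : ℕ} [NeZero n] (f : ZMod n → Bool) (c : ZMod n) :
    ∑ i, (f (i + c)).toNat = ∑ i, (f i).toNat :=
  Fintype.sum_equiv (Equiv.addRight c) _ _ fun _ => rfl

theorem leftEnds_eq_rightEnds {n : ℕ} [NeZero n] (r : ZMod n → Bool) :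
    leftEnds r = ∑ i, (r (i + 2) && r (i + 3) && !r (i + 4)).toNat := by
  -- both sides complement the number of triples `111` in the number of pairs `11`
  have h1 : ∑ i, (r i && r (i + 1)).toNat =
      leftEnds r + ∑ i, (r i && r (i + 1) && r (i + 2)).toNat := by
    rw [← sum_toNat_shift _ 1, leftEnds, ← Finset.sum_add_distrib]
    refine Finset.sum_congr rfl fun i _ => ?_
    rw [add_assoc, one_add_one_eq_two]
    cases r i <;> cases r (i + 1) <;> cases r (i + 2) <;> rfl
  have h2 : ∑ i, (r i && r (i + 1)).toNat =
      ∑ i, (r (i + 2) && r (i + 3) && !r (i + 4)).toNat +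
        ∑ i, (r i && r (i + 1) && r (i + 2)).toNat := by
    have h := sum_toNat_shift (fun i => r i && r (i + 1) && !r (i + 2)) 2
    simp only [add_assoc] at h
    norm_num at h
    rw [h, ← Finset.sum_add_distrib]
    refine Finset.sum_congr rfl fun i _ => ?_
    cases r i <;> cases r (i + 1) <;> cases r (i + 2) <;> rfl
  omega

namespace Pattern
variable {n : ℕ}

/-- A pattern is admissible if its rows, unrolled to `ℤ`, are. -/
def IsAdmissible (P : Pattern n) : Prop :=
  Admissible (fun j => P.row1 (j : ZMod n)) fun j => P.row2 (j : ZMod n)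

/-- The groups of the first row are singletons. -/
def IsReduced (P : Pattern n) : Prop := ∀ i, P.row1 i = true → P.row1 (i + 1) = false

/-- The middle positions of the blocks of length three of the first row (in an admissible
pattern). -/
def centers (P : Pattern n) (i : ZMod n) : Bool := P.row1 (i - 1) && P.row1 i && P.row1 (i + 1)

/-- Delete the entries of the first row marked by `δ`. -/
def erase (P : Pattern n) (δ : ZMod n → Bool) : Pattern n where
  row1 i := P.row1 i && !δ i
  row2 := P.row2
  below i hi := P.below i (by simp_all)

/-- Delete the entries of the first row marked by `δ` and their neighbours in both rows. -/
def cut (P : Pattern n) (δ : ZMod n → Bool) : Pattern n where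
  row1 i := P.row1 i && !δ (i - 1) && !δ i && !δ (i + 1)
  row2 i := P.row2 i && !δ i
  below i hi := by
    have := P.below i
    simp_all

/-- The pattern formed by the second and the third row after the entries of the first row,
together with their lower neighbours and all neighbours of these, are deleted. -/
def slide (P : Pattern n) : Pattern n where
  row1 i := P.row2 i && !P.row1 (i - 1) && !P.row1 i && !P.row1 (i + 1)
  row2 i := !P.row1 i
  below i hi := by simp_all

/-- The reduced pattern that follows a reduced one: its first row is folded away, and the blocks
that appear in the new first row are cut. This is the necklace transformation on patterns. -/
def next (P : Pattern n) : Pattern n := P.slide.cut P.slide.centers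

/-- The local form of the `μ`-invariant; both agree for proper patterns. -/
def blocks [NeZero n] (P : Pattern n) : ℕ := leftEnds P.row1 + leftEnds P.row2

variable {P : Pattern n} {δ : ZMod n → Bool}

theorem centers_lift (hδ : ∀ i, δ i = true → P.centers i = true) (j : ℤ)
    (hj : δ (j : ZMod n) = true) :
    P.row1 ((j - 1 : ℤ) : ZMod n) = true ∧ P.row1 (j : ZMod n) = true ∧
      P.row1 ((j + 1 : ℤ) : ZMod n) = true := by
  have := hδ _ hj
  simp only [centers, Bool.and_eq_true] at this
  push_cast
  tauto

theorem IsReduced.lift (hr : P.IsReduced) (j : ℤ) (hj : P.row1 (j : ZMod n) = true) :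
    P.row1 ((j + 1 : ℤ) : ZMod n) = false := by
  push_cast
  exact hr _ hj

theorem IsAdmissible.erase (h : P.IsAdmissible) (hδ : ∀ i, δ i = true → P.centers i = true) :
    (P.erase δ).IsAdmissible :=
  Admissible.erase (δ := fun j => δ j) h (centers_lift hδ)

theorem IsAdmissible.cut (h : P.IsAdmissible) (hδ : ∀ i, δ i = true → P.centers i = true) :
    (P.cut δ).IsAdmissible := by
  have := Admissible.cut (δ := fun j => δ j) h (centers_lift hδ)
  unfold IsAdmissible
  push_cast at this
  exact this

theorem IsAdmissible.slide (h : P.IsAdmissible) (hr : P.IsReduced) : P.slide.IsAdmissible := by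
  have := Admissible.slide h hr.lift
  unfold IsAdmissible
  push_cast at this
  exact this

theorem IsAdmissible.isReduced_cut (h : P.IsAdmissible) : (P.cut P.centers).IsReduced := by
  refine forall_zmod_iff.2 fun j => ?_
  have h1 := h.no_pair_above (j - 1)
  have h2 := h.no_four (j - 1)
  simp only [Pattern.cut, centers]
  push_cast at h1 h2 ⊢
  ring_nf at h1 h2 ⊢
  grind

theorem IsAdmissible.next (h : P.IsAdmissible) (hr : P.IsReduced) : P.next.IsAdmissible :=
  (h.slide hr).cut fun _ => id

theorem IsAdmissible.isReduced_next (h : P.IsAdmissible) (hr : P.IsReduced) : P.next.IsReduced :=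
  (h.slide hr).isReduced_cut

variable [NeZero n]

theorem IsAdmissible.blocks_erase (h : P.IsAdmissible)
    (hδ : ∀ i, δ i = true → P.centers i = true) :
    (P.erase δ).blocks + ∑ i, (δ i).toNat = P.blocks := by
  have key : leftEnds P.row1 = leftEnds (P.erase δ).row1 + ∑ i, (δ i).toNat := by
    rw [← sum_toNat_shift δ 2, leftEnds, leftEnds, ← Finset.sum_add_distrib]
    refine Fintype.sum_congr _ _ (forall_zmod_iff.2 fun j => ?_)
    have := Admissible.toNat_left_end_erase (δ := fun j => δ j) h (centers_lift hδ) j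
    push_cast at this
    exact this
  have : leftEnds (P.erase δ).row2 = leftEnds P.row2 := rfl
  unfold blocks
  omega

/-- Cutting a block of the first row splits the block below it in two. -/
theorem IsAdmissible.blocks_cut (h : P.IsAdmissible)
    (hδ : ∀ i, δ i = true → P.centers i = true) : (P.cut δ).blocks = P.blocks := by
  have key : leftEnds P.row1 = leftEnds (P.cut δ).row1 + ∑ i, (δ i).toNat := by
    rw [← sum_toNat_shift δ 2, leftEnds, leftEnds, ← Finset.sum_add_distrib]
    refine Fintype.sum_congr _ _ (forall_zmod_iff.2 fun j => ?_)
    have := Admissible.toNat_left_end_cut (δ := fun j => δ j) h (centers_lift hδ) j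
    push_cast at this
    simp only [Pattern.cut]
    ring_nf at this ⊢
    exact this
  have key2 : leftEnds (P.cut δ).row2 = leftEnds P.row2 + ∑ i, (δ i).toNat := by
    rw [leftEnds, leftEnds, ← Finset.sum_add_distrib]
    refine Fintype.sum_congr _ _ (forall_zmod_iff.2 fun j => ?_)
    have := Admissible.toNat_left_end_cut_below (δ := fun j => δ j) h (centers_lift hδ) j
    push_cast at this
    exact this
  unfold blocks
  omega

theorem IsReduced.leftEnds_row1 (hr : P.IsReduced) : leftEnds P.row1 = 0 := by
  refine Finset.sum_eq_zero fun i _ => ?_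
  have := hr (i + 1)
  rw [add_assoc, one_add_one_eq_two] at this
  cases h1 : P.row1 (i + 1) <;> simp_all

/-- Folding exchanges the ends of blocks: a right end of a block of the second row is turned into
a left end of a block of the new second row, or belongs to a block of length three, which becomes
a block of the new first row. -/
theorem IsAdmissible.blocks_slide (h : P.IsAdmissible) (hr : P.IsReduced) :
    P.slide.blocks = P.blocks := by
  have h0 := hr.leftEnds_row1
  have h1 : leftEnds P.slide.row2 = ∑ i, (P.row1 i && !P.row2 (i + 2)).toNat +
      ∑ i, (P.row1 i && !P.row1 (i + 2) && P.row2 (i + 2) && !P.row2 (i + 3)).toNat := by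
    rw [leftEnds, ← Finset.sum_add_distrib]
    refine Fintype.sum_congr _ _ (forall_zmod_iff.2 fun j => ?_)
    have := Admissible.toNat_last h hr.lift j
    push_cast at this
    simpa only [Pattern.slide, Bool.not_not] using this
  have h2 : leftEnds P.row2 = ∑ i, ((P.row1 (i + 2) && !P.row2 (i + 4)) ||
      (P.row1 (i + 1) && !P.row1 (i + 3) && P.row2 (i + 3) && !P.row2 (i + 4))).toNat +
      leftEnds P.slide.row1 := by
    rw [leftEnds_eq_rightEnds, leftEnds, ← Finset.sum_add_distrib]
    refine Fintype.sum_congr _ _ (forall_zmod_iff.2 fun j => ?_)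
    have := Admissible.toNat_right_end h (q := fun j => P.slide.row1 j)
      (fun i => by simp [Pattern.slide]) j
    push_cast at this
    exact this
  have h3 : ∑ i, ((P.row1 (i + 2) && !P.row2 (i + 4)) ||
      (P.row1 (i + 1) && !P.row1 (i + 3) && P.row2 (i + 3) && !P.row2 (i + 4))).toNat =
      ∑ i, (P.row1 (i + 2) && !P.row2 (i + 4)).toNat +
      ∑ i, (P.row1 (i + 1) && !P.row1 (i + 3) && P.row2 (i + 3) && !P.row2 (i + 4)).toNat := by
    rw [← Finset.sum_add_distrib]
    refine Finset.sum_congr rfl fun i _ => toNat_eq_add (by simp) ?_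
    have := hr (i + 1)
    rw [add_assoc, one_add_one_eq_two] at this
    cases h1 : P.row1 (i + 2) <;> simp_all
  have h4 := sum_toNat_shift (fun i => P.row1 i && !P.row2 (i + 2)) 2
  have h5 := sum_toNat_shift
    (fun i => P.row1 i && !P.row1 (i + 2) && P.row2 (i + 2) && !P.row2 (i + 3)) 1
  simp only [add_assoc] at h4 h5
  norm_num at h4 h5
  unfold blocks
  omega

theorem IsAdmissible.blocks_next (h : P.IsAdmissible) (hr : P.IsReduced) :
    P.next.blocks = P.blocks := by
  rw [Pattern.next, (h.slide hr).blocks_cut fun _ => id, h.blocks_slide hr]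

end Pattern

/-! ### The Witten index of an induced subgraph -/

section Witten
variable {V W : Type*} [Fintype V] [Fintype W]

open Classical in
/-- The alternating count of the independent sets of `G` contained in `A`, that is, the Witten
index of the subgraph induced on `A`. -/
noncomputable def signedCount (G : SimpleGraph V) (A : Set V) : ℤ :=
  ∑ s ∈ (Finset.univ : Finset (Finset V)).filter
    fun s : Finset V => (s : Set V) ⊆ A ∧ G.IsIndepSet (s : Set V),
    (-1) ^ s.card

theorem wittenIndex_eq_signedCount (G : SimpleGraph V) :
    wittenIndex G = signedCount G Set.univ := by
  classical
  have h : ((Finset.univ : Finset (Finset V)).filter fun s : Finset V => (s : Set V) ⊆ Set.univ ∧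
      G.IsIndepSet (s : Set V)) =
      (insert ∅ ((Finset.univ : Finset (Finset V)).filter
        fun s : Finset V => s ∈ (indepComplex G).faces) : Finset (Finset V)) := by
    ext s
    rcases s.eq_empty_or_nonempty with rfl | hs
    · simp [SimpleGraph.IsIndepSet]
    · simp only [Set.subset_univ, true_and, Finset.mem_filter, Finset.mem_univ, Finset.mem_insert,
        hs.ne_empty, false_or]
      exact ⟨fun h => ⟨hs, h⟩, fun h => h.2⟩
  unfold wittenIndex signedCount eulerChar
  rw [h, Finset.sum_insert, Finset.card_empty, pow_zero, sub_eq_add_neg, ← Finset.sum_neg_distrib]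
  · congr 1
    refine Finset.sum_congr (by ext; simp) fun s hs => ?_
    obtain ⟨c, hc⟩ : ∃ c, s.card = c + 1 :=
      Nat.exists_eq_succ_of_ne_zero (Finset.card_pos.2 (Finset.mem_filter.1 hs).2.1).ne'
    rw [hc, Nat.add_sub_cancel, pow_succ]
    ring
  · intro h0
    exact Finset.not_nonempty_empty (Finset.mem_filter.1 h0).2.1

theorem signedCount_image (G : SimpleGraph V) (H : SimpleGraph W) (f : H ↪g G) (A : Set W) :
    signedCount G (f '' A) = signedCount H A := by
  classical
  symm
  refine Finset.sum_bij (fun s _ => s.map f.toEmbedding) ?_ ?_ ?_ ?_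
  · intro s hs
    simp only [Finset.mem_filter, Finset.mem_univ, true_and] at hs ⊢
    refine ⟨?_, ?_⟩
    · rw [Finset.coe_map]
      exact Set.image_mono hs.1
    · rw [Finset.coe_map]
      rintro _ ⟨a, ha, rfl⟩ _ ⟨b, hb, rfl⟩ hab hadj
      exact hs.2 ha hb (fun h => hab (by rw [h])) (f.map_adj_iff.1 hadj)
  · intro s _ t _ h
    exact Finset.map_injective _ h
  · intro t ht
    simp only [Finset.mem_filter, Finset.mem_univ, true_and] at ht
    refine ⟨Finset.univ.filter fun a : W => f a ∈ t, ?_, ?_⟩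
    · simp only [Finset.mem_filter, Finset.mem_univ, true_and, Finset.coe_filter]
      refine ⟨fun a ha => ?_, fun a ha b hb hab hadj => ?_⟩
      · obtain ⟨b, hb, hba⟩ := ht.1 ha
        rwa [← f.injective hba]
      · exact ht.2 ha hb (fun h => hab (f.injective h)) (f.map_adj_iff.2 hadj)
    · ext v
      simp only [Finset.mem_map, Finset.mem_filter, Finset.mem_univ, true_and]
      constructor
      · rintro ⟨a, ha, rfl⟩
        exact ha
      · intro hv
        obtain ⟨b, hb, rfl⟩ := ht.1 hv
        exact ⟨b, hv, rfl⟩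
  · intro s _
    rw [Finset.card_map]

theorem wittenIndex_induce (G : SimpleGraph V) (A : Set V) [Fintype A] :
    wittenIndex (G.induce A) = signedCount G A := by
  rw [wittenIndex_eq_signedCount, ← signedCount_image G _ (SimpleGraph.Embedding.induce A)]
  congr 1
  rw [Set.image_univ]
  exact Subtype.range_coe

variable (G : SimpleGraph V)

/-- Independent sets avoid `v`, or contain `v` and avoid its neighbours. -/
theorem signedCount_eq_sub {A : Set V} {v : V} (hv : v ∈ A) :
    signedCount G A =
      signedCount G (A \ {v}) - signedCount G {w ∈ A | w ≠ v ∧ ¬ G.Adj v w} := by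
  classical
  unfold signedCount
  rw [← Finset.sum_filter_add_sum_filter_not _ (fun s : Finset V => v ∉ s), sub_eq_add_neg,
    ← Finset.sum_neg_distrib, Finset.filter_filter, Finset.filter_filter]
  congr 1
  · refine Finset.sum_congr (Finset.filter_congr fun s _ => ?_) fun _ _ => rfl
    exact ⟨fun h => ⟨fun w hw => ⟨h.1.1 hw, fun e => h.2 (Finset.mem_coe.1 (e ▸ hw))⟩, h.1.2⟩,
      fun h => ⟨⟨fun w hw => (h.1 hw).1, h.2⟩, fun hv => (h.1 hv).2 rfl⟩⟩
  · symm
    refine Finset.sum_bij (fun s _ => insert v s) ?_ ?_ ?_ ?_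
    · intro s hs
      simp only [Finset.mem_filter, Finset.mem_univ, true_and, not_not] at hs ⊢
      refine ⟨⟨?_, ?_⟩, Finset.mem_insert_self _ _⟩
      · rw [Finset.coe_insert, Set.insert_subset_iff]
        exact ⟨hv, fun w hw => (hs.1 hw).1⟩
      · rw [Finset.coe_insert]
        refine Set.Pairwise.insert hs.2 fun w hw _ => ⟨(hs.1 hw).2.2, fun h => (hs.1 hw).2.2 h.symm⟩
    · intro s hs t ht h
      simp only [Finset.mem_filter, Finset.mem_univ, true_and] at hs ht
      have h1 : v ∉ s := fun h => (hs.1 h).2.1 rfl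
      have h2 : v ∉ t := fun h => (ht.1 h).2.1 rfl
      rw [← Finset.erase_insert h1, h, Finset.erase_insert h2]
    · intro t ht
      simp only [Finset.mem_filter, Finset.mem_univ, true_and, not_not] at ht
      refine ⟨t.erase v, ?_, Finset.insert_erase ht.2⟩
      simp only [Finset.mem_filter, Finset.mem_univ, true_and, Finset.coe_erase]
      refine ⟨fun w hw => ⟨ht.1.1 hw.1, hw.2, ?_⟩, ht.1.2.mono Set.sdiff_subset⟩
      exact ht.1.2 ht.2 hw.1 (Ne.symm hw.2)
    · intro s hs
      simp only [Finset.mem_filter, Finset.mem_univ, true_and] at hs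
      have h1 : v ∉ s := fun h => (hs.1 h).2.1 rfl
      rw [Finset.card_insert_of_notMem h1, pow_succ]
      ring

theorem signedCount_eq_zero {A : Set V} {u : V} (hu : u ∈ A) (h : ∀ w ∈ A, ¬ G.Adj u w) :
    signedCount G A = 0 := by
  rw [signedCount_eq_sub G hu, sub_eq_zero]
  congr 1
  ext w
  simp only [Set.mem_sdiff, Set.mem_singleton_iff, Set.mem_ofPred_eq]
  exact ⟨fun hw => ⟨hw.1, hw.2, h w hw.1⟩, fun hw => ⟨hw.1, hw.2.1⟩⟩

/-- If `u` is a leaf with the neighbour `p`, then the closed neighbourhood of `p` can be removed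
at the cost of a sign. -/
theorem signedCount_leaf {A : Set V} {u p : V} (hu : u ∈ A) (hp : p ∈ A) (hup : G.Adj u p)
    (h : ∀ w ∈ A, G.Adj u w → w = p) :
    signedCount G A = - signedCount G {w ∈ A | w ≠ p ∧ ¬ G.Adj p w} := by
  rw [signedCount_eq_sub G hp, signedCount_eq_zero G (A := A \ {p}) ⟨hu, hup.ne⟩, zero_sub]
  exact fun w hw hadj => hw.2 (h w hw.1 hadj)

/-- Several leaves whose neighbours do not interfere can be treated at once. -/
theorem signedCount_leaves {ι : Type*} {A : Set V} (u p : ι → V) (L : Finset ι)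
    (hu : ∀ i ∈ L, u i ∈ A) (hp : ∀ i ∈ L, p i ∈ A) (hup : ∀ i ∈ L, G.Adj (u i) (p i))
    (h : ∀ i ∈ L, ∀ w ∈ A, G.Adj (u i) w → w = p i)
    (hpu : ∀ i ∈ L, ∀ j ∈ L, i ≠ j → u i ≠ p j ∧ ¬ G.Adj (p j) (u i))
    (hpp : ∀ i ∈ L, ∀ j ∈ L, i ≠ j → p i ≠ p j ∧ ¬ G.Adj (p j) (p i)) :
    signedCount G A =
      (-1) ^ L.card * signedCount G {w ∈ A | ∀ i ∈ L, w ≠ p i ∧ ¬ G.Adj (p i) w} := by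
  classical
  induction L using Finset.induction_on with
  | empty => simp
  | insert i L hi ih =>
    have hne : ∀ j ∈ L, i ≠ j := fun j hj hij => hi (hij ▸ hj)
    rw [ih (fun j hj => hu j (Finset.mem_insert_of_mem hj))
      (fun j hj => hp j (Finset.mem_insert_of_mem hj))
      (fun j hj => hup j (Finset.mem_insert_of_mem hj))
      (fun j hj => h j (Finset.mem_insert_of_mem hj))
      (fun j hj k hk => hpu j (Finset.mem_insert_of_mem hj) k (Finset.mem_insert_of_mem hk))
      (fun j hj k hk => hpp j (Finset.mem_insert_of_mem hj) k (Finset.mem_insert_of_mem hk)),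
      signedCount_leaf G (u := u i) (p := p i), Finset.card_insert_of_notMem hi, pow_succ,
      mul_neg, mul_assoc, neg_one_mul, mul_neg]
    · congr 3
      ext w
      simp only [Set.mem_ofPred_eq, Finset.forall_mem_insert]
      tauto
    · exact ⟨hu i (Finset.mem_insert_self _ _), fun j hj =>
        hpu i (Finset.mem_insert_self _ _) j (Finset.mem_insert_of_mem hj) (hne j hj)⟩
    · exact ⟨hp i (Finset.mem_insert_self _ _), fun j hj =>
        hpp i (Finset.mem_insert_self _ _) j (Finset.mem_insert_of_mem hj) (hne j hj)⟩
    · exact hup i (Finset.mem_insert_self _ _)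
    · exact fun w hw => h i (Finset.mem_insert_self _ _) w hw.1

end Witten

/-! ### Recurrences for the Witten indices of patterns -/

theorem zmod_one_ne_zero {n : ℕ} (hn : Even n) : (1 : ZMod n) ≠ 0 := by
  intro h
  have h1 : n ∣ 1 := (ZMod.natCast_eq_zero_iff 1 n).1 (by simpa using h)
  rw [Nat.dvd_one] at h1
  subst h1
  exact absurd hn (by decide)

/-- For even `n` the circulant graph has no loop to exclude, as `1 ≠ 0` modulo `n`. -/
theorem cylinder_adj {m n : ℕ} (hn : Even n) (v w : Fin m × ZMod n) :
    (cylinder m n).Adj v w ↔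
      (v.1.val = w.1.val ∧ (w.2 = v.2 + 1 ∨ v.2 = w.2 + 1)) ∨
        (v.2 = w.2 ∧ (v.1.val + 1 = w.1.val ∨ w.1.val + 1 = v.1.val)) := by
  have h1 := zmod_one_ne_zero hn
  rw [cylinder, SimpleGraph.boxProd_adj, SimpleGraph.pathGraph_adj, SimpleGraph.circulantGraph_adj,
    Set.mem_singleton_iff, Set.mem_singleton_iff, sub_eq_iff_eq_add', sub_eq_iff_eq_add',
    Fin.ext_iff]
  have h2 : v.2 = w.2 + 1 → v.2 ≠ w.2 := by
    intro h h'
    rw [h', left_eq_add] at h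
    exact h1 h
  have h3 : w.2 = v.2 + 1 → v.2 ≠ w.2 := by
    intro h h'
    rw [h', left_eq_add] at h
    exact h1 h
  tauto

namespace Pattern
variable {n : ℕ} {P Q : Pattern n}

theorem mem_keptVertices {m : ℕ} {v : Fin m × ZMod n} :
    v ∈ P.keptVertices m ↔
      (v.1.val = 0 → P.row1 v.2 = true) ∧ (v.1.val = 1 → P.row2 v.2 = true) :=
  Iff.rfl

variable [NeZero n]

theorem Z_eq_signedCount (P : Pattern n) (m : ℕ) :
    P.Z m = signedCount (cylinder m n) (P.keptVertices m) := by
  classical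
  rw [← wittenIndex_induce]
  unfold Z graph
  congr

/-- Independent sets avoid the entry `c` of the first row, or contain it and avoid its neighbours.
The identity fails for `m = 0`, where there is no first row. -/
theorem Z_eq_sub (hn : Even n) {c : ZMod n} (hc : P.row1 c = true) (m : ℕ) :
    P.Z (m + 1) = (P.erase fun i => decide (i = c)).Z (m + 1) -
      (P.cut fun i => decide (i = c)).Z (m + 1) := by
  rw [Z_eq_signedCount, Z_eq_signedCount, Z_eq_signedCount,
    signedCount_eq_sub (A := P.keptVertices (m + 1)) _ (v := (0, c)) ⟨fun _ => hc, by simp⟩]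
  congr 2
  · ext ⟨a, i⟩
    simp only [Set.mem_sdiff, Set.mem_singleton_iff, mem_keptVertices, erase, Prod.mk.injEq,
      Fin.ext_iff, Fin.val_zero, Bool.and_eq_true, Bool.not_eq_true', decide_eq_false_iff_not]
    tauto
  · ext ⟨a, i⟩
    simp only [Set.mem_ofPred_eq, mem_keptVertices, cut, cylinder_adj hn, ne_eq, Prod.mk.injEq,
      Fin.ext_iff, Fin.val_zero, Bool.and_eq_true, Bool.not_eq_true', decide_eq_false_iff_not,
      sub_eq_iff_eq_add, zero_add]
    have h1 : (i + 1 = c) = (c = i + 1) := propext eq_comm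
    have h2 : (i = c) = (c = i) := propext eq_comm
    rw [h1, h2]
    rcases Nat.lt_trichotomy a.val 1 with h | h | h
    · obtain h : a.val = 0 := by omega
      simp [h]
      tauto
    · simp [h]
    · have h3 : a.val ≠ 0 := by omega
      have h4 : a.val ≠ 1 := by omega
      simp [h3, h4, h3.symm, h4.symm]

/-- Each singleton of the first row is a leaf, attached to the entry below it. Once these leaves
are removed, the first row of the grid is empty, and the next two rows carry the folded pattern. -/
theorem Z_slide (hn : Even n) (hr : P.IsReduced) (m : ℕ) :
    P.Z (m + 2) = (-1) ^ (Finset.univ.filter fun i => P.row1 i = true).card *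
      P.slide.Z (m + 1) := by
  have h1 := zmod_one_ne_zero hn
  let f : cylinder (m + 1) n ↪g cylinder (m + 2) n :=
    { toFun := fun v => (v.1.succ, v.2)
      inj' := fun v w h => by
        simp only [Prod.mk.injEq, Fin.succ_inj] at h
        exact Prod.ext h.1 h.2
      map_rel_iff' := fun {v w} => by
        rw [cylinder_adj hn, cylinder_adj hn]
        change (v.1.val + 1 = w.1.val + 1 ∧ (w.2 = v.2 + 1 ∨ v.2 = w.2 + 1)) ∨ (v.2 = w.2 ∧
          (v.1.val + 1 + 1 = w.1.val + 1 ∨ w.1.val + 1 + 1 = v.1.val + 1)) ↔ _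
        simp only [Nat.add_right_cancel_iff] }
  rw [Z_eq_signedCount, Z_eq_signedCount, ← signedCount_image _ _ f,
    signedCount_leaves _ (fun i => ((0 : Fin (m + 2)), i)) (fun i => ((1 : Fin (m + 2)), i))
      (Finset.univ.filter fun i => P.row1 i = true)]
  · congr 2
    ext ⟨a, i⟩
    simp only [Set.mem_ofPred_eq, Finset.mem_filter, Finset.mem_univ, true_and]
    refine Fin.cases ?_ (fun b => ?_) a
    · constructor
      · rintro ⟨h, h'⟩
        have h2 : (cylinder (m + 2) n).Adj (1, i) (0, i) :=
          (cylinder_adj hn _ _).2 (Or.inr ⟨rfl, by simp⟩)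
        exact absurd h2 (h' i (h.1 rfl)).2
      · rintro ⟨v, _, hv⟩
        exact absurd (congrArg Prod.fst hv) (Fin.succ_ne_zero _)
    · have e : ((b.succ, i) ∈ f '' P.slide.keptVertices (m + 1)) ↔
          (b, i) ∈ P.slide.keptVertices (m + 1) :=
        Function.Injective.mem_set_image (f := f) f.injective (a := (b, i))
      rw [e]
      simp only [mem_keptVertices, slide, cylinder_adj hn, ne_eq, Prod.mk.injEq,
        Fin.ext_iff, Fin.val_succ, Fin.val_one, Bool.and_eq_true, Bool.not_eq_true']
      rcases Nat.lt_trichotomy b.val 1 with h | h | h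
      · obtain h : b.val = 0 := by omega
        simp only [h]
        norm_num
        constructor
        · rintro ⟨h2, h3⟩
          refine ⟨⟨⟨h2, ?_⟩, ?_⟩, ?_⟩ <;> by_contra h4 <;> rw [Bool.not_eq_false] at h4 <;>
            have := h3 _ h4 <;> simp at this
        · rintro ⟨⟨⟨h2, h3⟩, h4⟩, h5⟩
          refine ⟨h2, fun j hj => ⟨?_, ?_, ?_⟩⟩
          · rintro rfl
            simp_all
          · rintro rfl
            simp_all
          · rintro rfl
            simp_all
      · simp only [h]
        norm_num
        constructor
        · intro h2
          by_contra h4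
          rw [Bool.not_eq_false] at h4
          exact h2 _ h4 rfl
        · rintro h2 j hj rfl
          simp_all
      · have h3 : b.val ≠ 0 := by omega
        have h4 : b.val ≠ 1 := by omega
        simp [h3, h4]
  · intro i hi
    exact ⟨fun _ => (Finset.mem_filter.1 hi).2, by simp⟩
  · intro i hi
    exact ⟨by simp, fun _ => P.below _ (Finset.mem_filter.1 hi).2⟩
  · intro i hi
    exact (cylinder_adj hn _ _).2 (Or.inr ⟨rfl, by simp⟩)
  · rintro i hi ⟨a, j⟩ hw hadj
    rw [Finset.mem_filter] at hi
    rcases (cylinder_adj hn _ _).1 hadj with ⟨h2, h3⟩ | ⟨h2, h3⟩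
    · have h4 := hw.1 h2.symm
      rcases h3 with h3 | h3
      · simp only at h3 h4
        rw [h3, hr _ hi.2] at h4
        exact absurd h4 (by decide)
      · simp only at h3 h4
        have := hr _ h4
        rw [← h3, hi.2] at this
        exact absurd this (by decide)
    · simp only [Fin.val_zero] at h2 h3
      simp only [Prod.mk.injEq, Fin.ext_iff, Fin.val_one]
      exact ⟨by omega, h2.symm⟩
  · intro i _ j _ hij
    rw [cylinder_adj hn]
    simp [Ne.symm hij]
  · intro i hi j hj hij
    rw [Finset.mem_filter] at hi hj
    rw [cylinder_adj hn]
    simp only [ne_eq, Prod.mk.injEq, true_and]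
    refine ⟨hij, ?_⟩
    rintro (h | h)
    · rcases h with h | h
      · have := hr j hj.2
        rw [← h, hi.2] at this
        exact absurd this (by decide)
      · have := hr i hi.2
        rw [← h, hj.2] at this
        exact absurd this (by decide)
    · exact hij h.1.symm

/-- Patterns that differ by an isometry of the circle have the same Witten indices. -/
theorem Z_congr (hn : Even n) (e : ZMod n ≃ ZMod n)
    (he : ∀ i j, (e j = e i + 1 ∨ e i = e j + 1) ↔ (j = i + 1 ∨ i = j + 1))
    (h1 : ∀ i, Q.row1 (e i) = P.row1 i) (h2 : ∀ i, Q.row2 (e i) = P.row2 i) (m : ℕ) :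
    Q.Z m = P.Z m := by
  let f : cylinder m n ↪g cylinder m n :=
    { toFun := fun v => (v.1, e v.2)
      inj' := fun v w h => by
        simp only [Prod.mk.injEq, e.injective.eq_iff] at h
        exact Prod.ext h.1 h.2
      map_rel_iff' := fun {v w} => by
        rw [cylinder_adj hn, cylinder_adj hn]
        change (v.1.val = w.1.val ∧ (e w.2 = e v.2 + 1 ∨ e v.2 = e w.2 + 1)) ∨ (e v.2 = e w.2 ∧
          (v.1.val + 1 = w.1.val ∨ w.1.val + 1 = v.1.val)) ↔ _
        rw [he, e.injective.eq_iff] }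
  rw [Z_eq_signedCount, Z_eq_signedCount, ← signedCount_image _ _ f (P.keptVertices m)]
  congr 1
  ext ⟨a, i⟩
  obtain ⟨j, rfl⟩ := e.surjective i
  have e' : ((a, e j) ∈ f '' P.keptVertices m) ↔ (a, j) ∈ P.keptVertices m :=
    Function.Injective.mem_set_image (f := f) f.injective (a := (a, j))
  rw [e', mem_keptVertices, mem_keptVertices]
  simp only [h1, h2]

end Pattern

/-! ### Proper patterns are admissible -/

section Rows
variable {n : ℕ} {r : ZMod n → Bool}

theorem IsGroup.lt_of_forall {s : ZMod n} {l j k : ℕ} (h : IsGroup r s l) (hj : j < l)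
    (hk : ∀ t ≤ k, r (s + (j : ZMod n) + (t : ZMod n)) = true) : j + k < l := by
  by_contra hlt
  have := hk (l - j) (by omega)
  rw [Nat.cast_sub hj.le, add_assoc, add_sub_cancel, h.2.2.2] at this
  exact absurd this (by decide)

theorem IsGroup.eq_zero_of_prev {s : ZMod n} {l j : ℕ} (h : IsGroup r s l) (hj : j < l)
    (h0 : r (s + (j : ZMod n) - 1) = false) : j = 0 := by
  by_contra h1
  obtain ⟨c, rfl⟩ := Nat.exists_eq_succ_of_ne_zero h1
  have := h.2.2.1 c (by omega)
  push_cast at h0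
  rw [← add_assoc, add_sub_cancel_right, this] at h0
  exact absurd h0 (by decide)

theorem IsGroup.succ_eq_of_next {s : ZMod n} {l j : ℕ} (h : IsGroup r s l) (hj : j < l)
    (h0 : r (s + (j : ZMod n) + 1) = false) : j + 1 = l := by
  by_contra h1
  have := h.2.2.1 (j + 1) (by omega)
  push_cast at this
  rw [← add_assoc, h0] at this
  exact absurd this (by decide)

theorem IsGroup.eq_one {s : ZMod n} {l : ℕ} (h : IsGroup r s l) (h' : IsSingleton r s) : l = 1 := by
  have := h.succ_eq_of_next (j := 0) h.1 (by simpa using h'.2.2.2)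
  omega

theorem IsRun.group_ne_two {x s : ZMod n} {w j l : ℕ} (h : IsRun r x w) (hj : j < w)
    (hsx : s = x + (j : ZMod n)) (hs : IsGroup r s l) : l = 1 ∨ 3 ≤ l := by
  subst hsx
  rcases h.2.2.2.2.2.2 j hj l hs with h | h
  · exact Or.inl (hs.eq_one h)
  · exact Or.inr h.1

theorem isGroup_two {i : ZMod n} (h0 : r i = false) (h1 : r (i + 1) = true)
    (h2 : r (i + 2) = true) (h3 : r (i + 3) = false) : IsGroup r (i + 1) 2 := by
  refine ⟨by decide, by rwa [add_sub_cancel_right], fun j hj => ?_, ?_⟩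
  · interval_cases j
    · simpa using h1
    · rw [add_assoc]
      norm_num
      exact h2
  · rw [add_assoc]
    norm_num
    exact h3

theorem isGroup_three {i : ZMod n} (h0 : r i = false) (h1 : r (i + 1) = true)
    (h2 : r (i + 2) = true) (h3 : r (i + 3) = true) (h4 : r (i + 4) = false) :
    IsGroup r (i + 1) 3 := by
  refine ⟨by decide, by rwa [add_sub_cancel_right], fun j hj => ?_, ?_⟩
  · rw [add_assoc]
    interval_cases j <;> norm_num <;> assumption
  · rw [add_assoc]
    norm_num
    exact h4

theorem IsNiceRun.group_le {x s : ZMod n} {w j l : ℕ} (h : IsNiceRun r x w) (hj : j < w)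
    (hsx : s = x + (j : ZMod n)) (hs : IsGroup r s l) : l = 1 ∨ l = 3 := by
  rcases h.1.group_ne_two hj hsx hs with h1 | h1
  · exact Or.inl h1
  · subst hsx
    exact Or.inr (h.2 j hj l ⟨h1, hs⟩)

theorem forall_le_three {i : ZMod n} (h0 : r i = true) (h1 : r (i + 1) = true)
    (h2 : r (i + 2) = true) (h3 : r (i + 3) = true) (t : ℕ) (ht : t ≤ 3) :
    r (i + (t : ZMod n)) = true := by
  interval_cases t <;> norm_num <;> assumption

variable [NeZero n]

theorem exists_eq_add_natCast (x i : ZMod n) : ∃ j < n, i = x + (j : ZMod n) :=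
  ⟨(i - x).val, ZMod.val_lt _, by rw [ZMod.natCast_zmod_val]; ring⟩

/-- In a row that is not full each `1` lies in a group. -/
theorem exists_isGroup {z i : ZMod n} (hz : r z = false) (hi : r i = true) :
    ∃ (s : ZMod n) (l j : ℕ), IsGroup r s l ∧ j < l ∧ i = s + (j : ZMod n) := by
  classical
  have h1 : ∃ j : ℕ, r (i - (j : ZMod n)) = false := by
    obtain ⟨j, _, hj⟩ := exists_eq_add_natCast z i
    exact ⟨j, by rwa [hj, add_sub_cancel_right]⟩
  have h2 : ∃ j : ℕ, r (i + (j : ZMod n)) = false := by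
    obtain ⟨j, _, hj⟩ := exists_eq_add_natCast i z
    exact ⟨j, by rwa [← hj]⟩
  set a := Nat.find h1 with ha
  set b := Nat.find h2 with hb
  have ha' : r (i - (a : ZMod n)) = false := Nat.find_spec h1
  have hb' : r (i + (b : ZMod n)) = false := Nat.find_spec h2
  have ha0 : a ≠ 0 := by
    intro h
    rw [h, Nat.cast_zero, sub_zero, hi] at ha'
    exact absurd ha' (by decide)
  obtain ⟨c, hc⟩ := Nat.exists_eq_succ_of_ne_zero ha0
  have hb0 : b ≠ 0 := by
    intro h
    rw [h, Nat.cast_zero, add_zero, hi] at hb'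
    exact absurd hb' (by decide)
  refine ⟨i - (c : ZMod n), c + b, c, ⟨by omega, ?_, ?_, ?_⟩, by omega, by ring⟩
  · rw [hc] at ha'
    push_cast at ha'
    rw [← ha']
    congr 1
    ring
  · intro j hj
    rcases le_or_gt c j with h | h
    · have := Nat.find_min h2 (m := j - c) (by omega)
      rw [Bool.not_eq_false, Nat.cast_sub h] at this
      rw [← this]
      congr 1
      ring
    · have := Nat.find_min h1 (m := c - j) (by omega)
      rw [Bool.not_eq_false, Nat.cast_sub h.le] at this
      rw [← this]
      congr 1
      ring
  · rw [← hb']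
    push_cast
    congr 1
    ring

theorem IsRun.no_two_zeros {x : ZMod n} {w : ℕ} (hw : w + 1 = n) (h : IsRun r x w) (i : ZMod n) :
    r i = true ∨ r (i + 1) = true := by
  obtain ⟨j, hj, rfl⟩ := exists_eq_add_natCast x i
  obtain ⟨h1, h2, h3, h4, h5, h6, h7⟩ := h
  rcases lt_trichotomy (j + 1) w with h | h | h
  · have := h6 j h
    push_cast at this
    rw [add_assoc]
    simp only [not_and, Bool.not_eq_false] at this
    cases h' : r (x + (j : ZMod n))
    · exact Or.inr (this h')
    · exact Or.inl rfl
  · subst h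
    left
    rw [← h4]
    push_cast
    congr 1
    ring
  · right
    have : j + 1 = n := by omega
    have hc : ((j + 1 : ℕ) : ZMod n) = 0 := by rw [this, ZMod.natCast_self]
    push_cast at hc
    rw [add_assoc, hc, add_zero, h3]

theorem IsRun.isGroup {x s : ZMod n} {w l : ℕ} (hw : w + 1 = n) (h : IsRun r x w)
    (hs : IsGroup r s l) : ∃ j < w, s = x + (j : ZMod n) := by
  obtain ⟨j, hj, rfl⟩ := exists_eq_add_natCast x s
  refine ⟨j, ?_, rfl⟩
  by_contra hjw
  have hjw' : j + 1 = n := by omega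
  have hc : ((j + 1 : ℕ) : ZMod n) = 0 := by rw [hjw', ZMod.natCast_self]
  have h1 := hs.2.2.1 0 hs.1
  push_cast at hc
  rw [Nat.cast_zero, add_zero, eq_neg_of_add_eq_zero_left hc, ← sub_eq_add_neg, h.2.1] at h1
  exact absurd h1 (by decide)

theorem IsRun.no_pair {x : ZMod n} {w : ℕ} (hw : w + 1 = n) (h : IsRun r x w) (i : ZMod n)
    (h0 : r i = false) (h3 : r (i + 3) = false) (h1 : r (i + 1) = true) : r (i + 2) = false := by
  by_contra h2
  rw [Bool.not_eq_false] at h2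
  have hg := isGroup_two h0 h1 h2 h3
  obtain ⟨j, hj, hs⟩ := h.isGroup hw hg
  have := h.group_ne_two hj hs hg
  omega

/-- Blocks can be counted by their first two entries. -/
theorem numBlocks_eq_leftEnds (h : ∀ i, r i = false → r (i + 3) = false → r (i + 1) = true →
    r (i + 2) = false) : numBlocks r = leftEnds r := by
  classical
  have key : ∀ i : ZMod n, (∃ l, IsBlock r (i + 1) l) ↔
      (!r i && r (i + 1) && r (i + 2)) = true := by
    intro i
    simp only [Bool.and_eq_true, Bool.not_eq_true']
    constructor
    · rintro ⟨l, hl, h1, h2, h3, h4⟩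
      refine ⟨⟨by rwa [add_sub_cancel_right] at h2, by simpa using h3 0 (by omega)⟩, ?_⟩
      have := h3 1 (by omega)
      rw [add_assoc] at this
      norm_num at this
      exact this
    · rintro ⟨⟨h0, h1⟩, h2⟩
      obtain ⟨s, l, j, hs, hj, hsj⟩ := exists_isGroup h0 h1
      have hj0 := hs.eq_zero_of_prev hj (by rwa [← hsj, add_sub_cancel_right])
      subst hj0
      rw [Nat.cast_zero, add_zero] at hsj
      subst hsj
      have h3 : 0 + 1 < l := hs.lt_of_forall hs.1 fun t ht => by
        interval_cases t
        · simpa using h1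
        · rw [Nat.cast_zero, Nat.cast_one, add_zero, add_assoc, one_add_one_eq_two]
          exact h2
      refine ⟨l, ?_, hs⟩
      by_contra h4
      have h5 : l = 2 := by omega
      subst h5
      have h6 := hs.2.2.2
      rw [add_assoc] at h6
      norm_num at h6
      rw [h i h0 h6 h1] at h2
      exact absurd h2 (by decide)
  have h1 : {i : ZMod n | ∃ l, IsBlock r i l} = (fun i => i + 1) ''
      {i | (!r i && r (i + 1) && r (i + 2)) = true} := by
    ext i
    simp only [Set.mem_ofPred_eq, Set.mem_image, ← key]
    exact ⟨fun h => ⟨i - 1, by rwa [sub_add_cancel], sub_add_cancel _ _⟩,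
      fun ⟨j, hj, hij⟩ => hij ▸ hj⟩
  rw [numBlocks, h1, Set.ncard_image_of_injective _ (add_left_injective 1), leftEnds,
    Set.ncard_eq_toFinset_card', Finset.card_eq_sum_ones, Set.toFinset_ofPred, Finset.sum_filter]
  refine Finset.sum_congr rfl fun i _ => ?_
  cases (!r i && r (i + 1) && r (i + 2)) <;> rfl

/-- The first group of a nice run. -/
theorem IsNiceRun.first {x : ZMod n} {w : ℕ} (h : IsNiceRun r x w) :
    IsSingleton r x ∨ IsBlock r x 3 := by
  obtain ⟨s, l, j, hs, hj, hsj⟩ := exists_isGroup h.1.2.1 h.1.2.2.1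
  have hj0 := hs.eq_zero_of_prev hj (by rw [← hsj]; exact h.1.2.1)
  subst hj0
  rw [Nat.cast_zero, add_zero] at hsj
  subst hsj
  rcases h.group_le (j := 0) h.1.1 (by simp) hs with rfl | rfl
  · exact Or.inl hs
  · exact Or.inr ⟨le_rfl, hs⟩

/-- The last group of a nice run. -/
theorem IsNiceRun.last {x : ZMod n} {w : ℕ} (h : IsNiceRun r x w) :
    IsSingleton r (x + (w : ZMod n) - 1) ∨ IsBlock r (x + (w : ZMod n) - 3) 3 := by
  obtain ⟨h1, h2, h3, h4, h5, -⟩ := h.1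
  obtain ⟨s, l, j, hs, hj, hsj⟩ := exists_isGroup h2 h4
  have hl := hs.succ_eq_of_next hj (by rwa [← hsj, sub_add_cancel])
  have hw : j < w := by
    by_contra hw
    have := hs.2.2.1 (j - w) (by omega)
    rw [Nat.cast_sub (by omega), ← add_sub_assoc, ← hsj, sub_right_comm, add_sub_cancel_right,
      h2] at this
    exact absurd this (by decide)
  have hsx : s = x + ((w - 1 - j : ℕ) : ZMod n) := by
    rw [Nat.cast_sub (by omega), Nat.cast_sub h1, Nat.cast_one, ← add_sub_assoc, ← add_sub_assoc,
      hsj, add_sub_cancel_right]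
  rcases h.group_le (by omega) hsx hs with rfl | rfl
  · left
    obtain rfl : j = 0 := by omega
    rw [Nat.cast_zero, add_zero] at hsj
    rw [hsj]
    exact hs
  · right
    obtain rfl : j = 2 := by omega
    have : x + (w : ZMod n) - 3 = s := by
      push_cast at hsj
      linear_combination hsj
    rw [this]
    exact ⟨le_rfl, hs⟩

end Rows

namespace Pattern
variable {n : ℕ} {P : Pattern n} {s : ZMod n} {l : ℕ}

/-- The groups above a long block have length one or three. -/
theorem NiceRunAbove.group (h : P.NiceRunAbove s l) {j k : ℕ} (hj : j < l)
    (hk : IsGroup P.row1 (s + (j : ZMod n)) k) : k = 1 ∨ k = 3 := by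
  obtain ⟨a, w, b, hl, hrun, ha, hb, -⟩ := h
  have h1 : P.row1 (s + (j : ZMod n)) = true := by simpa using hk.2.2.1 0 hk.1
  have hja : a ≤ j := by
    by_contra hja
    rw [ha j (by omega)] at h1
    exact absurd h1 (by decide)
  have hjw : j < a + w := by
    by_contra hjw
    have := hb (j - (a + w)) (by omega)
    rw [Nat.add_sub_cancel' (by omega), h1] at this
    exact absurd this (by decide)
  refine hrun.group_le (j := j - a) (by omega) ?_ hk
  rw [Nat.cast_sub hja]
  ring

variable [NeZero n]

/-- The first two positions above a long block. -/
theorem NiceRunAbove.left (h : P.NiceRunAbove s l) :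
    P.row1 s = false ∧ (P.row1 (s + 1) = true → P.row1 (s + 2) = false) := by
  obtain ⟨a, w, b, hl, hrun, hl0, -, hblock, hsing, -⟩ := h
  have h0 : ∀ j < a, P.row1 (s + (j : ZMod n)) = false := hl0
  rcases hrun.first with h1 | h1
  · rcases hsing h1 with rfl | rfl
    · refine ⟨by simpa using h0 0 (by omega), fun _ => ?_⟩
      have := h1.2.2.2
      rw [add_assoc] at this
      norm_num at this
      exact this
    · refine ⟨by simpa using h0 0 (by omega), fun h => ?_⟩
      have := h0 1 (by omega)
      rw [Nat.cast_one, h] at this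
      exact absurd this (by decide)
  · obtain rfl := hblock h1
    refine ⟨by simpa using h0 0 (by omega), fun h => ?_⟩
    have := h0 1 (by omega)
    rw [Nat.cast_one, h] at this
    exact absurd this (by decide)

/-- The last two positions above a long block; `e` is the first position after the block. -/
theorem NiceRunAbove.right (h : P.NiceRunAbove s l) {e : ZMod n} (he : e = s + (l : ZMod n)) :
    P.row1 (e - 1) = false ∧ (P.row1 (e - 2) = true → P.row1 (e - 3) = false) := by
  obtain ⟨a, w, b, hl, hrun, -, h0, -, -, hblock, hsing⟩ := h
  have h1 : ∀ j : ℕ, j < b → P.row1 (e - ((j + 1 : ℕ) : ZMod n)) = false := by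
    intro j hj
    obtain ⟨c, hc⟩ := Nat.exists_eq_add_of_le (Nat.succ_le_of_lt hj)
    rw [← h0 c (by omega)]
    congr 1
    rw [he, hl, hc]
    push_cast
    ring
  have hlast := hrun.last
  have hx : s + (a : ZMod n) + (w : ZMod n) = s + ((a + w : ℕ) : ZMod n) := by push_cast; ring
  rw [hx] at hlast
  have hz : P.row1 (e - 1) = false ∧ (b = 2 → P.row1 (e - 2) = false) := by
    constructor
    · have : 0 < b := by
        rcases hlast with h | h
        · have := hsing h
          omega
        · have := hblock h
          omega
      simpa using h1 0 this
    · intro hb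
      have := h1 1 (by omega)
      norm_num at this
      exact this
  refine ⟨hz.1, fun h2 => ?_⟩
  have hb : b ≠ 2 := fun hb => by
    rw [hz.2 hb] at h2
    exact absurd h2 (by decide)
  rcases hlast with h | h
  · obtain rfl : b = 1 := (hsing h).resolve_right hb
    have := h.2.1
    rw [← this]
    congr 1
    rw [he, hl]
    push_cast
    ring
  · exact absurd (hblock h) hb

theorem NiceRunAbove.dense (h : P.NiceRunAbove s l) {j : ℕ} (hj : j + 3 < l) :
    P.row1 (s + (j : ZMod n) + 1) = true ∨ P.row1 (s + (j : ZMod n) + 2) = true := by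
  obtain ⟨a, w, b, hl, hrun, -, -, hb1, hs1, hb2, hs2⟩ := h
  have hx : s + (a : ZMod n) + (w : ZMod n) = s + ((a + w : ℕ) : ZMod n) := by push_cast; ring
  have ha : a ≤ 2 := by
    rcases hrun.first with h | h
    · have := hs1 h
      omega
    · exact (hb1 h).le
  have hb : b ≤ 2 := by
    have hlast := hrun.last
    rw [hx] at hlast
    rcases hlast with h | h
    · have := hs2 h
      omega
    · exact (hb2 h).le
  obtain ⟨⟨h1, h2, h3, h4, h5, h6, h7⟩, -⟩ := hrun
  rcases lt_or_ge (j + 1) a with h | h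
  · right
    have : a = 2 ∧ j = 0 := by omega
    obtain ⟨rfl, rfl⟩ := this
    rw [← h3]
    push_cast
    congr 1
    ring
  · obtain ⟨t, ht⟩ := Nat.exists_eq_add_of_le h
    have hc : (j : ZMod n) + 1 = (a : ZMod n) + (t : ZMod n) := by
      have := congrArg (Nat.cast : ℕ → ZMod n) ht
      push_cast at this
      exact this
    have e1 : s + (j : ZMod n) + 1 = s + (a : ZMod n) + (t : ZMod n) := by
      linear_combination hc
    have e2 : s + (j : ZMod n) + 2 = s + (a : ZMod n) + ((t + 1 : ℕ) : ZMod n) := by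
      push_cast
      linear_combination hc
    rcases lt_or_ge (t + 1) w with h' | h'
    · have := h6 t h'
      rw [e1, e2]
      simp only [not_and, Bool.not_eq_false] at this
      cases h'' : P.row1 (s + (a : ZMod n) + (t : ZMod n))
      · exact Or.inr (this h'')
      · exact Or.inl rfl
    · left
      obtain rfl : w = t + 1 := by omega
      rw [e1, ← h4]
      push_cast
      congr 1
      ring

theorem IsProper.isAdmissible_and_mu (h : P.IsProper) : P.IsAdmissible ∧ P.mu = P.blocks := by
  suffices hs : ((∀ i, P.row2 i = true ∨ P.row2 (i + 1) = true) ∧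
      (∀ i, P.row2 i = false → P.row2 (i + 3) = false → P.row2 (i + 1) = true →
        P.row2 (i + 2) = false)) ∧
      (∀ i, P.row2 i = false → P.row2 (i + 4) = false → P.row1 (i + 2) = false) ∧
      (∀ i, P.row2 i = false → P.row1 (i + 1) = false) ∧
      (∀ i, P.row2 (i + 1) = false → P.row1 i = false) ∧
      (∀ i, P.row2 i = false → P.row1 (i + 2) = true → P.row1 (i + 3) = false) ∧
      (∀ i, P.row2 (i + 3) = false → P.row1 (i + 1) = true → P.row1 i = false) ∧
      (∀ i, P.row2 i = true → P.row2 (i + 1) = true → P.row2 (i + 2) = true →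
        P.row2 (i + 3) = true → P.row1 (i + 1) = true ∨ P.row1 (i + 2) = true) ∧
      (∀ i, P.row1 i = false → P.row1 (i + 3) = false → P.row1 (i + 1) = true →
        P.row1 (i + 2) = false) ∧
      (∀ i, P.row1 i = true → P.row1 (i + 1) = true → P.row1 (i + 2) = true →
        P.row1 (i + 3) = false) by
    obtain ⟨⟨h1, h2⟩, h3, h4, h5, h6, h7, h8, h9, h10⟩ := hs
    refine ⟨⟨fun i => ?_, fun i => ?_, fun i => ?_, fun i => ?_, fun i => ?_, fun i => ?_,
      fun i => ?_, fun i => ?_, fun i => ?_, fun i => ?_, fun i => ?_⟩, ?_⟩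
    · exact P.below _
    · push_cast; exact h1 _
    · push_cast; exact h2 _
    · push_cast; exact h3 _
    · push_cast; exact h4 _
    · push_cast; exact h5 _
    · push_cast; exact h6 _
    · push_cast; exact h7 _
    · push_cast; exact h8 _
    · push_cast; exact h9 _
    · push_cast; exact h10 _
    · rw [mu, blocks, numBlocks_eq_leftEnds h2, numBlocks_eq_leftEnds h9]
  by_cases hfull : ∀ i, P.row2 i = true
  · obtain ⟨x, w, hw, hrun⟩ := h.full hfull
    have h2 := hrun.1.no_two_zeros hw
    simp only [hfull, true_or, implies_true, Bool.true_eq_false, false_imp_iff, true_and,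
      forall_const]
    refine ⟨fun i => ?_, hrun.1.no_pair hw, fun i h0 h1 h2 => ?_⟩
    · have := h2 (i + 1)
      rwa [add_assoc, one_add_one_eq_two] at this
    · by_contra h3
      rw [Bool.not_eq_false] at h3
      obtain ⟨s, l, j, hs, hj, hsj⟩ := exists_isGroup hrun.1.2.1 h0
      have hl : j + 3 < l := hs.lt_of_forall hj fun t ht => by
        rw [← hsj]
        exact forall_le_three h0 h1 h2 h3 t ht
      obtain ⟨t, ht, hst⟩ := hrun.1.isGroup hw hs
      have := hrun.group_le ht hst hs
      omega
  · obtain ⟨x, w, hw, hrun⟩ := h.second_row.resolve_right hfull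
    obtain ⟨z, hz⟩ := not_forall.1 hfull
    rw [Bool.not_eq_true] at hz
    have hz1 : P.row1 z = false := by
      by_contra h1
      rw [Bool.not_eq_false] at h1
      rw [P.below z h1] at hz
      exact absurd hz (by decide)
    have h2 := hrun.no_two_zeros hw
    have h3 := hrun.no_pair hw
    -- every group of the second row that has an entry above it is long
    have long : ∀ s l j, IsGroup P.row2 s l → j < l → P.row1 (s + (j : ZMod n)) = true →
        4 ≤ l ∧ P.NiceRunAbove s l := by
      intro s l j hs hj hx
      obtain ⟨t, ht, hst⟩ := hrun.isGroup hw hs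
      have h4 : 4 ≤ l := by
        rcases hrun.group_ne_two ht hst hs with rfl | hl
        · obtain rfl : j = 0 := by omega
          rw [Nat.cast_zero, add_zero, h.singleton s hs] at hx
          exact absurd hx (by decide)
        · by_contra hl4
          obtain rfl : l = 3 := by omega
          rw [h.block_three s ⟨le_rfl, hs⟩ j hj] at hx
          exact absurd hx (by decide)
      exact ⟨h4, h.block_long s l h4 ⟨by omega, hs⟩⟩
    have group : ∀ i, P.row1 i = true → ∃ (s : ZMod n) (l j : ℕ), IsGroup P.row2 s l ∧ j < l ∧
        i = s + (j : ZMod n) ∧ 4 ≤ l ∧ P.NiceRunAbove s l := by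
      intro i hi
      obtain ⟨s, l, j, hs, hj, hsj⟩ := exists_isGroup hz (P.below i hi)
      exact ⟨s, l, j, hs, hj, hsj, long s l j hs hj (by rwa [← hsj])⟩
    have three : ∀ i, P.row2 i = false → P.row2 (i + 4) = false → P.row1 (i + 2) = false := by
      intro i h0 h4
      by_contra hx
      rw [Bool.not_eq_false] at hx
      have e1 := (h2 i).resolve_left (by simp [h0])
      have e3 := (h2 (i + 3)).resolve_right (by rw [add_assoc]; norm_num; exact h4)
      have hg := isGroup_three h0 e1 (P.below _ hx) e3 h4
      have := h.block_three (i + 1) ⟨le_rfl, hg⟩ 1 (by omega)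
      rw [Nat.cast_one, add_assoc, one_add_one_eq_two, hx] at this
      exact absurd this (by decide)
    refine ⟨⟨h2, h3⟩, three, fun i h0 => ?_, fun i h0 => ?_, fun i h0 hx => ?_,
      fun i h0 hx => ?_, fun i y0 y1 y2 y3 => ?_, fun i x0 x3 x1 => ?_, fun i x0 x1 x2 => ?_⟩
    · by_contra hx
      rw [Bool.not_eq_false] at hx
      obtain ⟨s, l, j, hs, hj, hsj, -, hR⟩ := group _ hx
      obtain rfl := hs.eq_zero_of_prev hj (by rwa [← hsj, add_sub_cancel_right])
      rw [hsj, Nat.cast_zero, add_zero, hR.left.1] at hx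
      exact absurd hx (by decide)
    · by_contra hx
      rw [Bool.not_eq_false] at hx
      obtain ⟨s, l, j, hs, hj, hsj, -, hR⟩ := group _ hx
      obtain rfl := hs.succ_eq_of_next hj (by rwa [← hsj])
      have := (hR.right (e := i + 1) (by rw [hsj]; push_cast; ring)).1
      rw [add_sub_cancel_right, hx] at this
      exact absurd this (by decide)
    · obtain ⟨s, l, j, hs, hj, hsj, -, hR⟩ := group _ hx
      have y1 := (h2 i).resolve_left (by simp [h0])
      have hj1 : j = 1 := by
        have hj0 : j ≠ 0 := by
          rintro rfl
          have := hs.2.1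
          rw [Nat.cast_zero, add_zero] at hsj
          rw [← hsj] at this
          have e : i + 2 - 1 = i + 1 := by ring
          rw [e, y1] at this
          exact absurd this (by decide)
        have e : s + ((j - 1 : ℕ) : ZMod n) - 1 = i := by
          rw [Nat.cast_sub (by omega)]
          push_cast
          linear_combination -hsj
        have := hs.eq_zero_of_prev (j := j - 1) (by omega) (by rwa [e])
        omega
      subst hj1
      have e : i + 2 = s + 1 := by rw [hsj, Nat.cast_one]
      have e' : i + 3 = s + 2 := by linear_combination e
      rw [e']
      rw [e] at hx
      exact hR.left.2 hx
    · obtain ⟨s, l, j, hs, hj, hsj, -, hR⟩ := group _ hx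
      have y2 := (h2 (i + 2)).resolve_right (by
        have e : i + 2 + 1 = i + 3 := by ring
        rw [e]
        simp [h0])
      have hjl : j + 1 ≠ l := by
        rintro rfl
        have := hs.2.2.2
        push_cast at this
        rw [← add_assoc, ← hsj, add_assoc, one_add_one_eq_two, y2] at this
        exact absurd this (by decide)
      have hjl' := hs.succ_eq_of_next (j := j + 1) (by omega) (by
        have e : s + ((j + 1 : ℕ) : ZMod n) + 1 = i + 3 := by
          push_cast
          linear_combination -hsj
        rwa [e])
      have := (hR.right (e := i + 3) (by rw [← hjl']; push_cast; linear_combination hsj)).2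
      have e1 : i + 3 - 2 = i + 1 := by ring
      have e2 : i + 3 - 3 = i := by ring
      rw [e1, e2] at this
      exact this hx
    · obtain ⟨s, l, j, hs, hj, hsj⟩ := exists_isGroup hz y0
      have hl : j + 3 < l := hs.lt_of_forall hj fun t ht => by
        rw [← hsj]
        exact forall_le_three y0 y1 y2 y3 t ht
      rw [hsj]
      exact (h.block_long s l (by omega) ⟨by omega, hs⟩).dense hl
    · by_contra x2
      rw [Bool.not_eq_false] at x2
      obtain ⟨s, l, j, hs, hj, hsj, -, hR⟩ := group _ x1
      have hg := isGroup_two x0 x1 x2 x3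
      rw [hsj] at hg
      have := hR.group hj hg
      omega
    · by_contra x3
      rw [Bool.not_eq_false] at x3
      obtain ⟨s', l', j', hs', hj', hsj'⟩ := exists_isGroup hz1 x0
      have hl : j' + 3 < l' := hs'.lt_of_forall hj' fun t ht => by
        rw [← hsj']
        exact forall_le_three x0 x1 x2 x3 t ht
      obtain ⟨s, l, j, hs, hj, hsj, -, hR⟩ := group s' (by simpa using hs'.2.2.1 0 hs'.1)
      rw [hsj] at hs'
      have := hR.group hj hs'
      omega

end Pattern

/-! ### Local rules for the ends of blocks -/

namespace Admissible
variable {x y q : ℤ → Bool}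

/-- The blocks of the folded first row come from the blocks of length three of the second row. -/
theorem center_iff (h : Admissible x y)
    (hq : ∀ i, q i = (y i && !x (i - 1) && !x i && !x (i + 1))) (i : ℤ) :
    (q (i - 1) && q i && q (i + 1)) = (!y (i - 2) && y i && !y (i + 2)) := by
  rw [Bool.eq_iff_iff]
  simp only [hq, Bool.and_eq_true, Bool.not_eq_true']
  grind [h.dense (i - 2), h.dense (i - 1), h.no_two_zeros (i - 2), h.no_two_zeros (i + 1),
    h.next_zero (i - 2), h.prev_zero (i + 1), h.three (i - 2), h.le (i - 2), h.le (i + 2),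
    h.next_zero (i + 2), h.prev_zero (i - 3)]

-- in the following lemmas, `X` and `Y` are the rows of the next pattern, and `C` marks the centers
-- of the blocks that are cut
variable {C X Y : ℤ → Bool}

/-- Let a block of the lower row `y` end before `j`. A block of the next lower row `Y` starts at the
position to which the stone at this end jumps: at `j - 1`, or at `j - 2` if the stone vector has
length two. The value of `X` tells the new stone vector. -/
theorem right_end_next (h : Admissible x y)
    (hC : ∀ i, C i = (!y (i - 2) && y i && !y (i + 2)))
    (hX : ∀ i, X i = (y i && !x (i - 1) && !x i && !x (i + 1) && !C (i - 1) && !C i && !C (i + 1)))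
    (hY : ∀ i, Y i = (!x i && !C i)) (j : ℤ)
    (h1 : y (j - 2) = true) (h2 : y (j - 1) = true) (h3 : y j = false) :
    (¬ (x (j - 2) = false ∧ y (j - 4) = true) →
      Y (j - 2) = false ∧ Y (j - 1) = true ∧ Y j = true ∧ X j = false) ∧
    (x (j - 2) = false ∧ y (j - 4) = true →
      Y (j - 3) = false ∧ Y (j - 2) = true ∧ Y (j - 1) = true ∧ X (j - 1) = true) := by
  simp only [hX, hY, hC]
  grind [h.dense (j - 4), h.no_pair (j - 3), h.prev_zero (j - 1), h.le j, h.le (j - 3),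
    h.prev_zero (j - 3), h.next_zero (j - 3), h.next_zero j, h.three (j - 4)]

/-- The mirror image of `right_end_next`. -/
theorem left_end_next (h : Admissible x y) (hr : ∀ i, x i = true → x (i + 1) = false)
    (hC : ∀ i, C i = (!y (i - 2) && y i && !y (i + 2)))
    (hX : ∀ i, X i = (y i && !x (i - 1) && !x i && !x (i + 1) && !C (i - 1) && !C i && !C (i + 1)))
    (hY : ∀ i, Y i = (!x i && !C i)) (i : ℤ)
    (h1 : y (i - 1) = false) (h2 : y i = true) (h3 : y (i + 1) = true) :
    (¬ (x (i + 1) = false ∧ y (i + 3) = true) →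
      Y (i + 1) = false ∧ Y i = true ∧ Y (i - 1) = true ∧ X (i - 1) = false) ∧
    (x (i + 1) = false ∧ y (i + 3) = true →
      Y (i + 2) = false ∧ Y (i + 1) = true ∧ Y i = true ∧ X i = true) := by
  simp only [hX, hY, hC]
  grind [h.dense i, h.no_pair (i - 1), h.prev_zero (i - 2), h.le (i - 1), h.le (i + 2),
    h.prev_zero (i + 1), h.next_zero (i + 1), h.next_zero (i - 1), h.three (i - 1)]

/-- Each block of the next lower row starts at a position to which the stone at the right end of a
block of the lower row jumps, by one or by two. -/
theorem left_end_of_next (h : Admissible x y)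
    (hC : ∀ i, C i = (!y (i - 2) && y i && !y (i + 2)))
    (hY : ∀ i, Y i = (!x i && !C i)) (p : ℤ)
    (h1 : Y (p - 1) = false) (h2 : Y p = true) (h3 : Y (p + 1) = true) :
    (y (p - 1) = true ∧ y p = true ∧ y (p + 1) = false ∧
      ¬ (x (p - 1) = false ∧ y (p - 3) = true)) ∨
    (y p = true ∧ y (p + 1) = true ∧ y (p + 2) = false ∧ x p = false ∧ y (p - 2) = true) := by
  simp only [hY, hC, Bool.and_eq_true, Bool.and_eq_false_iff, Bool.not_eq_true',
    Bool.not_eq_false'] at h1 h2 h3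
  grind [h.dense (p - 1), h.no_two_zeros p, h.le (p - 1), h.next_zero (p - 2), h.next_zero (p - 1),
    h.prev_zero (p - 1), h.prev_zero (p - 2)]

/-- The mirror image of `left_end_of_next`. -/
theorem right_end_of_next (h : Admissible x y)
    (hC : ∀ i, C i = (!y (i - 2) && y i && !y (i + 2)))
    (hY : ∀ i, Y i = (!x i && !C i)) (p : ℤ)
    (h1 : Y (p - 2) = true) (h2 : Y (p - 1) = true) (h3 : Y p = false) :
    (y (p - 2) = false ∧ y (p - 1) = true ∧ y p = true ∧
      ¬ (x p = false ∧ y (p + 2) = true)) ∨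
    (y (p - 3) = false ∧ y (p - 2) = true ∧ y (p - 1) = true ∧ x (p - 1) = false ∧
      y (p + 1) = true) := by
  simp only [hY, hC, Bool.and_eq_true, Bool.and_eq_false_iff, Bool.not_eq_true',
    Bool.not_eq_false'] at h1 h2 h3
  grind [h.dense (p - 3), h.no_two_zeros (p - 2), h.le p, h.next_zero (p - 1), h.next_zero p,
    h.prev_zero p, h.prev_zero (p - 1)]

end Admissible

/-! ### The ends of the blocks of the next pattern -/

namespace Pattern
variable {n : ℕ}

/-- A block of the second row starts at `i`. -/
def leftEnd (P : Pattern n) (i : ZMod n) : Bool :=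
  !P.row2 (i - 1) && P.row2 i && P.row2 (i + 1)

/-- A block of the second row ends at `i - 1`. -/
def rightEnd (P : Pattern n) (i : ZMod n) : Bool :=
  P.row2 (i - 2) && P.row2 (i - 1) && !P.row2 i

/-- The vector of the stone at the left end of a block: the distance to the run above, or one if
the block has length three. -/
def leftVec (P : Pattern n) (i : ZMod n) : ℤ :=
  if P.row1 (i + 1) = false ∧ P.row2 (i + 3) = true then 2 else 1

/-- The vector of the stone at the right end of a block: minus the distance to the run above, or
minus one if the block has length three. -/
def rightVec (P : Pattern n) (i : ZMod n) : ℤ :=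
  if P.row1 (i - 2) = false ∧ P.row2 (i - 4) = true then -2 else -1

theorem leftVec_pos (P : Pattern n) (i : ZMod n) : 0 < P.leftVec i := by
  unfold leftVec
  split_ifs <;> decide

theorem rightVec_neg (P : Pattern n) (i : ZMod n) : P.rightVec i < 0 := by
  unfold rightVec
  split_ifs <;> decide

variable {P : Pattern n}

theorem not_leftEnd_and_rightEnd {i : ZMod n} (h : P.leftEnd i = true) : P.rightEnd i = false := by
  simp only [leftEnd, rightEnd, Bool.and_eq_true, Bool.not_eq_true'] at h ⊢
  simp [h.1.1]

theorem IsAdmissible.no_pair' (h : P.IsAdmissible) (i : ZMod n) (h0 : P.row2 i = false)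
    (h3 : P.row2 (i + 3) = false) (h1 : P.row2 (i + 1) = true) : P.row2 (i + 2) = false := by
  revert i
  refine forall_zmod_iff.2 fun i h0 h3 h1 => ?_
  have := h.no_pair i
  push_cast at this
  exact this h0 h3 h1

theorem IsAdmissible.rightEnd_add_three_iff (h : P.IsAdmissible) {p : ZMod n}
    (hp : P.leftEnd p = true) : P.rightEnd (p + 3) = true ↔ P.row2 (p + 3) = false := by
  simp only [leftEnd, rightEnd, Bool.and_eq_true, Bool.not_eq_true'] at hp ⊢
  have e1 : p + 3 - 2 = p + 1 := by ring
  have e2 : p + 3 - 1 = p + 2 := by ring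
  rw [e1, e2]
  refine ⟨fun h => h.2, fun h3 => ⟨⟨hp.2, ?_⟩, h3⟩⟩
  by_contra h2
  have := h.no_pair' (p - 1) hp.1.1 (by
    have e : p - 1 + 3 = p + 2 := by ring
    rw [e]
    simpa using h2) (by rw [sub_add_cancel]; exact hp.1.2)
  have e : p - 1 + 2 = p + 1 := by ring
  rw [e, hp.2] at this
  exact absurd this (by decide)

theorem IsAdmissible.leftEnd_iff_of_rightEnd (h : P.IsAdmissible) {p : ZMod n}
    (hp : P.rightEnd (p + 3) = true) : P.leftEnd p = true ↔ P.row2 (p - 1) = false := by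
  simp only [leftEnd, rightEnd, Bool.and_eq_true, Bool.not_eq_true'] at hp ⊢
  have e1 : p + 3 - 2 = p + 1 := by ring
  have e2 : p + 3 - 1 = p + 2 := by ring
  rw [e1, e2] at hp
  refine ⟨fun h => h.1.1, fun h3 => ⟨⟨h3, ?_⟩, hp.1.1⟩⟩
  by_contra h2
  have := h.no_pair' p (by simpa using h2) hp.2 hp.1.1
  rw [hp.1.2] at this
  exact absurd this (by decide)

theorem IsAdmissible.centers_slide (h : P.IsAdmissible) (i : ZMod n) :
    P.slide.centers i = (!P.row2 (i - 2) && P.row2 i && !P.row2 (i + 2)) := by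
  revert i
  refine forall_zmod_iff.2 fun j => ?_
  have := Admissible.center_iff h (q := fun j => P.slide.row1 j)
    (fun i => by simp [Pattern.slide]) j
  push_cast at this
  exact this

theorem lift_centers (h : P.IsAdmissible) (j : ℤ) :
    P.slide.centers (j : ZMod n) =
    (!P.row2 ((j - 2 : ℤ) : ZMod n) && P.row2 (j : ZMod n) && !P.row2 ((j + 2 : ℤ) : ZMod n)) := by
  push_cast
  exact h.centers_slide _

theorem lift_next_row1 (j : ℤ) : P.next.row1 (j : ZMod n) =
    (P.row2 (j : ZMod n) && !P.row1 ((j - 1 : ℤ) : ZMod n) && !P.row1 (j : ZMod n) &&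
      !P.row1 ((j + 1 : ℤ) : ZMod n) && !P.slide.centers ((j - 1 : ℤ) : ZMod n) &&
      !P.slide.centers (j : ZMod n) && !P.slide.centers ((j + 1 : ℤ) : ZMod n)) := by
  push_cast
  rfl

theorem lift_next_row2 (j : ℤ) : P.next.row2 (j : ZMod n) =
    (!P.row1 (j : ZMod n) && !P.slide.centers (j : ZMod n)) := rfl

/-- The vector of the stone at the left end of a block before the vectors of facing stones at
distance three are shortened. -/
def leftVec' (P : Pattern n) (i : ZMod n) : ℤ := if P.row1 (i + 1) = true then 1 else 2

/-- The vector of the stone at the right end of a block before the vectors of facing stones at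
distance three are shortened. -/
def rightVec' (P : Pattern n) (i : ZMod n) : ℤ := if P.row1 (i - 2) = true then -1 else -2

theorem leftVec'_pos (P : Pattern n) (i : ZMod n) : 0 < P.leftVec' i := by
  unfold leftVec'
  split_ifs <;> decide

theorem rightVec'_neg (P : Pattern n) (i : ZMod n) : P.rightVec' i < 0 := by
  unfold rightVec'
  split_ifs <;> decide

/-- A stone at the right end of a block jumps to the left end of a block of the next pattern. -/
theorem IsAdmissible.rightEnd_next (h : P.IsAdmissible) (j : ZMod n)
    (hj : P.rightEnd j = true) : P.next.leftEnd (j + P.rightVec j) = true ∧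
      turn (P.rightVec j) = P.next.leftVec' (j + P.rightVec j) := by
  revert j
  refine forall_zmod_iff.2 fun j hj => ?_
  simp only [rightEnd, Bool.and_eq_true, Bool.not_eq_true'] at hj
  have := Admissible.right_end_next h (lift_centers h) lift_next_row1 lift_next_row2 j
    (by push_cast; exact hj.1.1) (by push_cast; exact hj.1.2) hj.2
  push_cast at this
  unfold rightVec leftEnd
  split_ifs with h1
  · obtain ⟨h2, h3, h4, h5⟩ := this.2 h1
    have e1 : (j : ZMod n) + ((-2 : ℤ) : ZMod n) - 1 = j - 3 := by push_cast; ring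
    have e2 : (j : ZMod n) + ((-2 : ℤ) : ZMod n) = j - 2 := by push_cast; ring
    have e3 : (j : ZMod n) + ((-2 : ℤ) : ZMod n) + 1 = j - 1 := by push_cast; ring
    rw [leftVec', e1, e3, e2, h2, h3, h4, h5]
    simp [turn]
  · obtain ⟨h2, h3, h4, h5⟩ := this.1 h1
    have e1 : (j : ZMod n) + ((-1 : ℤ) : ZMod n) - 1 = j - 2 := by push_cast; ring
    have e2 : (j : ZMod n) + ((-1 : ℤ) : ZMod n) = j - 1 := by push_cast; ring
    have e3 : (j : ZMod n) + ((-1 : ℤ) : ZMod n) + 1 = j := by push_cast; ring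
    rw [leftVec', e1, e3, e2, h2, h3, h4, h5]
    simp [turn]

/-- A stone at the left end of a block jumps to the right end of a block of the next pattern. -/
theorem IsAdmissible.leftEnd_next (h : P.IsAdmissible) (hr : P.IsReduced) (i : ZMod n)
    (hi : P.leftEnd i = true) : P.next.rightEnd (i + P.leftVec i) = true ∧
      turn (P.leftVec i) = P.next.rightVec' (i + P.leftVec i) := by
  revert i
  refine forall_zmod_iff.2 fun i hi => ?_
  simp only [leftEnd, Bool.and_eq_true, Bool.not_eq_true'] at hi
  have := Admissible.left_end_next h hr.lift (lift_centers h) lift_next_row1 lift_next_row2 i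
    (by push_cast; exact hi.1.1) hi.1.2 (by push_cast; exact hi.2)
  push_cast at this
  unfold leftVec rightEnd
  split_ifs with h1
  · obtain ⟨h2, h3, h4, h5⟩ := this.2 h1
    have e1 : (i : ZMod n) + ((2 : ℤ) : ZMod n) - 2 = i := by push_cast; ring
    have e2 : (i : ZMod n) + ((2 : ℤ) : ZMod n) - 1 = i + 1 := by push_cast; ring
    have e3 : (i : ZMod n) + ((2 : ℤ) : ZMod n) = i + 2 := by push_cast; ring
    rw [rightVec', e1, e2, e3, h2, h3, h4, h5]
    simp [turn]
  · obtain ⟨h2, h3, h4, h5⟩ := this.1 h1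
    have e1 : (i : ZMod n) + ((1 : ℤ) : ZMod n) - 2 = i - 1 := by push_cast; ring
    have e2 : (i : ZMod n) + ((1 : ℤ) : ZMod n) - 1 = i := by push_cast; ring
    have e3 : (i : ZMod n) + ((1 : ℤ) : ZMod n) = i + 1 := by push_cast; ring
    rw [rightVec', e1, e2, e3, h2, h3, h4, h5]
    simp [turn]

theorem IsAdmissible.leftEnd_of_next (h : P.IsAdmissible) (p : ZMod n)
    (hp : P.next.leftEnd p = true) : ∃ j, P.rightEnd j = true ∧ j + P.rightVec j = p := by
  revert p
  refine forall_zmod_iff.2 fun p hp => ?_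
  simp only [leftEnd, Bool.and_eq_true, Bool.not_eq_true'] at hp
  have := Admissible.left_end_of_next h (lift_centers h) lift_next_row2 p
    (by push_cast; exact hp.1.1) hp.1.2 (by push_cast; exact hp.2)
  push_cast at this
  unfold rightVec rightEnd
  rcases this with ⟨h1, h2, h3, h4⟩ | ⟨h1, h2, h3, h4⟩
  · refine ⟨p + 1, ?_⟩
    have e1 : (p : ZMod n) + 1 - 2 = p - 1 := by ring
    have e2 : (p : ZMod n) + 1 - 1 = p := by ring
    have e3 : (p : ZMod n) + 1 - 4 = p - 3 := by ring
    rw [e1, e2, e3, if_neg h4, h1, h2, h3]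
    simp
  · refine ⟨p + 2, ?_⟩
    have e1 : (p : ZMod n) + 2 - 2 = p := by ring
    have e2 : (p : ZMod n) + 2 - 1 = p + 1 := by ring
    have e3 : (p : ZMod n) + 2 - 4 = p - 2 := by ring
    rw [e1, e2, e3, if_pos h4, h1, h2, h3]
    simp

theorem IsAdmissible.rightEnd_of_next (h : P.IsAdmissible) (p : ZMod n)
    (hp : P.next.rightEnd p = true) : ∃ i, P.leftEnd i = true ∧ i + P.leftVec i = p := by
  revert p
  refine forall_zmod_iff.2 fun p hp => ?_
  simp only [rightEnd, Bool.and_eq_true, Bool.not_eq_true'] at hp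
  have := Admissible.right_end_of_next h (lift_centers h) lift_next_row2 p
    (by push_cast; exact hp.1.1) (by push_cast; exact hp.1.2) hp.2
  push_cast at this
  unfold leftVec leftEnd
  rcases this with ⟨h1, h2, h3, h4⟩ | ⟨h1, h2, h3, h4⟩
  · refine ⟨p - 1, ?_⟩
    have e1 : (p : ZMod n) - 1 - 1 = p - 2 := by ring
    have e2 : (p : ZMod n) - 1 + 1 = p := by ring
    have e3 : (p : ZMod n) - 1 + 3 = p + 2 := by ring
    rw [e1, e2, e3, if_neg h4, h1, h2, h3]
    simp
  · refine ⟨p - 2, ?_⟩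
    have e1 : (p : ZMod n) - 2 - 1 = p - 3 := by ring
    have e2 : (p : ZMod n) - 2 + 1 = p - 1 := by ring
    have e3 : (p : ZMod n) - 2 + 3 = p + 1 := by ring
    rw [e1, e2, e3, if_pos h4, h1, h2, h3]
    simp

/-! ### The stones of a pattern -/

variable [NeZero n]

/-- The stones at the two ends of the blocks of the second row. The stone at `i` stands for the
point between the columns `i - 1` and `i`. -/
def stones (P : Pattern n) : Config n :=
  ((Finset.univ.filter fun i => P.leftEnd i = true).image fun i => (i, P.leftVec i)) ∪
    (Finset.univ.filter fun i => P.rightEnd i = true).image fun i => (i, P.rightVec i)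

theorem mem_stones {s : ZMod n × ℤ} : s ∈ P.stones ↔
    (P.leftEnd s.1 = true ∧ s.2 = P.leftVec s.1) ∨
      (P.rightEnd s.1 = true ∧ s.2 = P.rightVec s.1) := by
  obtain ⟨i, v⟩ := s
  simp only [stones, Finset.mem_union, Finset.mem_image, Finset.mem_filter, Finset.mem_univ,
    true_and, Prod.mk.injEq]
  constructor
  · rintro (⟨_, h, rfl, rfl⟩ | ⟨_, h, rfl, rfl⟩)
    · exact Or.inl ⟨h, rfl⟩
    · exact Or.inr ⟨h, rfl⟩
  · rintro (⟨h, rfl⟩ | ⟨h, rfl⟩)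
    · exact Or.inl ⟨i, h, rfl, rfl⟩
    · exact Or.inr ⟨i, h, rfl, rfl⟩

theorem leftEnd_of_pos {s : ZMod n × ℤ} (hs : s ∈ P.stones) (h : 0 < s.2) :
    P.leftEnd s.1 = true ∧ s.2 = P.leftVec s.1 := by
  refine (mem_stones.1 hs).resolve_right fun h' => ?_
  have := P.rightVec_neg s.1
  omega

theorem rightEnd_of_neg {s : ZMod n × ℤ} (hs : s ∈ P.stones) (h : s.2 < 0) :
    P.rightEnd s.1 = true ∧ s.2 = P.rightVec s.1 := by
  refine (mem_stones.1 hs).resolve_left fun h' => ?_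
  have := P.leftVec_pos s.1
  omega

theorem IsReduced.blocks_eq (hr : P.IsReduced) : P.blocks = leftEnds P.row2 := by
  rw [blocks, hr.leftEnds_row1, zero_add]

theorem card_stones (hr : P.IsReduced) : P.stones.card = 2 * P.blocks := by
  have e : ∀ f : ZMod n → Bool, (Finset.univ.filter fun i => f i = true).card =
      ∑ i, (f i).toNat := by
    intro f
    rw [Finset.card_eq_sum_ones, Finset.sum_filter]
    exact Finset.sum_congr rfl fun i _ => by cases f i <;> rfl
  have inj : ∀ f : ZMod n → ℤ, Function.Injective fun i => (i, f i) :=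
    fun f i j h => congrArg Prod.fst h
  rw [stones, Finset.card_union_of_disjoint, Finset.card_image_of_injective _ (inj _),
    Finset.card_image_of_injective _ (inj _), e, e, hr.blocks_eq, two_mul]
  · congr 1
    · rw [← sum_toNat_shift _ 1, leftEnds]
      refine Finset.sum_congr rfl fun i _ => ?_
      rw [leftEnd, add_sub_cancel_right, add_assoc, one_add_one_eq_two]
    · rw [← sum_toNat_shift _ 4, leftEnds_eq_rightEnds]
      refine Finset.sum_congr rfl fun i _ => ?_
      have e1 : i + 4 - 2 = i + 2 := by ring
      have e2 : i + 4 - 1 = i + 3 := by ring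
      rw [rightEnd, e1, e2]
  · rw [Finset.disjoint_left]
    intro s h1 h2
    simp only [Finset.mem_image, Finset.mem_filter, Finset.mem_univ, true_and] at h1 h2
    obtain ⟨i, hi, rfl⟩ := h1
    obtain ⟨j, hj, h⟩ := h2
    obtain rfl : j = i := congrArg Prod.fst h
    rw [not_leftEnd_and_rightEnd hi] at hj
    exact absurd hj (by decide)

/-! ### The necklace transformation -/

/-- After the steps JUMP and TURN the stones sit at the ends of the blocks of the next pattern. -/
theorem IsAdmissible.mem_jumpTurn (h : P.IsAdmissible) (hr : P.IsReduced) {s : ZMod n × ℤ} :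
    s ∈ jumpTurn P.stones ↔ (P.next.leftEnd s.1 = true ∧ s.2 = P.next.leftVec' s.1) ∨
      (P.next.rightEnd s.1 = true ∧ s.2 = P.next.rightVec' s.1) := by
  obtain ⟨p, w⟩ := s
  simp only [jumpTurn, Finset.mem_image, mem_stones, Prod.mk.injEq, Prod.exists]
  constructor
  · rintro ⟨i, v, ⟨h1, rfl⟩ | ⟨h1, rfl⟩, rfl, rfl⟩
    · exact Or.inr (h.leftEnd_next hr i h1)
    · exact Or.inl (h.rightEnd_next i h1)
  · rintro (⟨h1, rfl⟩ | ⟨h1, rfl⟩)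
    · obtain ⟨j, hj, rfl⟩ := h.leftEnd_of_next p h1
      exact ⟨j, _, Or.inr ⟨hj, rfl⟩, rfl, (h.rightEnd_next j hj).2⟩
    · obtain ⟨i, hi, rfl⟩ := h.rightEnd_of_next p h1
      exact ⟨i, _, Or.inl ⟨hi, rfl⟩, rfl, (h.leftEnd_next hr i hi).2⟩

theorem four_le_of_leftEnd (hn : Even n) {i : ZMod n} (h : P.leftEnd i = true) : 4 ≤ n := by
  have h2 : n ≠ 2 := by
    rintro rfl
    simp only [leftEnd, Bool.and_eq_true, Bool.not_eq_true'] at h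
    have e : i - 1 = i + 1 := by
      have : (2 : ZMod 2) = 0 := rfl
      linear_combination -this
    rw [e, h.2] at h
    exact absurd h.1.1 (by decide)
  obtain ⟨m, hm⟩ := hn
  have := NeZero.ne n
  omega

theorem cwDist_eq_three {x y : ZMod n} (hn : 4 ≤ n) : cwDist x y = 3 ↔ y = x + 3 := by
  have e : ((3 : ℕ) : ZMod n).val = 3 := ZMod.val_natCast_of_lt (by omega)
  unfold cwDist
  constructor
  · intro h
    have : ((y - x).val : ZMod n) = ((3 : ℕ) : ZMod n) := by rw [h]
    rw [ZMod.natCast_zmod_val] at this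
    push_cast at this
    linear_combination this
  · rintro rfl
    rw [add_sub_cancel_left]
    exact e

/-- The transformation of necklaces describes the passage to the next pattern. -/
theorem IsAdmissible.transform_stones (hn : Even n) (h : P.IsAdmissible) (hr : P.IsReduced) :
    transform P.stones = P.next.stones := by
  classical
  have hadm := h.next hr
  have left : ∀ p, P.next.leftEnd p = true →
      ((∃ t ∈ jumpTurn P.stones, FacingAtThree (p, P.next.leftVec' p) t ∨
        FacingAtThree t (p, P.next.leftVec' p)) ↔ P.next.row2 (p + 3) = false) := by
    intro p hp
    have h4 := four_le_of_leftEnd hn hp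
    have hpos : 0 < P.next.leftVec' p := leftVec'_pos _ _
    rw [← hadm.rightEnd_add_three_iff hp]
    constructor
    · rintro ⟨t, ht, ⟨-, h1, h2⟩ | ⟨-, h1, -⟩⟩
      · rw [cwDist_eq_three h4] at h2
        rw [← h2]
        refine (((h.mem_jumpTurn hr).1 ht).resolve_left fun h3 => ?_).1
        have : 0 < P.next.leftVec' t.1 := leftVec'_pos _ _
        omega
      · exact absurd h1 (by simpa using hpos.le)
    · intro h1
      exact ⟨(p + 3, P.next.rightVec' (p + 3)), (h.mem_jumpTurn hr).2 (Or.inr ⟨h1, rfl⟩),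
        Or.inl ⟨hpos, rightVec'_neg _ _, (cwDist_eq_three h4).2 rfl⟩⟩
  have right : ∀ p, P.next.rightEnd p = true →
      ((∃ t ∈ jumpTurn P.stones, FacingAtThree (p, P.next.rightVec' p) t ∨
        FacingAtThree t (p, P.next.rightVec' p)) ↔ P.next.row2 (p - 4) = false) := by
    intro p hp
    have hneg : P.next.rightVec' p < 0 := rightVec'_neg _ _
    have h4 : 4 ≤ n := by
      obtain ⟨i, hi, -⟩ := h.rightEnd_of_next p hp
      exact four_le_of_leftEnd hn hi
    have e : p = p - 3 + 3 := by ring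
    have e4 : p - 4 = p - 3 - 1 := by ring
    rw [e4, ← hadm.leftEnd_iff_of_rightEnd (by rwa [← e])]
    constructor
    · rintro ⟨t, ht, ⟨h1, -, -⟩ | ⟨h1, -, h2⟩⟩
      · exact absurd h1 (by simpa using hneg.le)
      · rw [cwDist_eq_three h4] at h2
        have h5 : p - 3 = t.1 := by
          simp only at h2
          rw [h2, add_sub_cancel_right]
        rw [h5]
        refine (((h.mem_jumpTurn hr).1 ht).resolve_right fun h3 => ?_).1
        have : P.next.rightVec' t.1 < 0 := rightVec'_neg _ _
        omega
    · intro h1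
      exact ⟨(p - 3, P.next.leftVec' (p - 3)), (h.mem_jumpTurn hr).2 (Or.inl ⟨h1, rfl⟩),
        Or.inr ⟨leftVec'_pos _ _, hneg, (cwDist_eq_three h4).2 e⟩⟩
  have left' : ∀ p, P.next.leftEnd p = true →
      (if ∃ t ∈ jumpTurn P.stones, FacingAtThree (p, P.next.leftVec' p) t ∨
        FacingAtThree t (p, P.next.leftVec' p) then (p, (P.next.leftVec' p).sign)
        else (p, P.next.leftVec' p)) = (p, P.next.leftVec p) := by
    intro p hp
    simp only [left p hp]
    unfold leftVec leftVec'
    cases P.next.row1 (p + 1) <;> cases P.next.row2 (p + 3) <;> simp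
  have right' : ∀ p, P.next.rightEnd p = true →
      (if ∃ t ∈ jumpTurn P.stones, FacingAtThree (p, P.next.rightVec' p) t ∨
        FacingAtThree t (p, P.next.rightVec' p) then (p, (P.next.rightVec' p).sign)
        else (p, P.next.rightVec' p)) = (p, P.next.rightVec p) := by
    intro p hp
    simp only [right p hp]
    unfold rightVec rightVec'
    cases P.next.row1 (p - 2) <;> cases P.next.row2 (p - 4) <;> simp
  ext s
  unfold transform fix
  rw [Finset.mem_image, mem_stones]
  constructor
  · rintro ⟨⟨p, w⟩, ht, rfl⟩
    rcases (h.mem_jumpTurn hr).1 ht with ⟨h1, h2⟩ | ⟨h1, h2⟩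
    · simp only at h1 h2
      subst h2
      rw [left' p h1]
      exact Or.inl ⟨h1, rfl⟩
    · simp only at h1 h2
      subst h2
      rw [right' p h1]
      exact Or.inr ⟨h1, rfl⟩
  · obtain ⟨p, w⟩ := s
    rintro (⟨h1, h2⟩ | ⟨h1, h2⟩)
    · simp only at h1 h2
      subst h2
      exact ⟨(p, P.next.leftVec' p), (h.mem_jumpTurn hr).2 (Or.inl ⟨h1, rfl⟩), left' p h1⟩
    · simp only at h1 h2
      subst h2
      exact ⟨(p, P.next.rightVec' p), (h.mem_jumpTurn hr).2 (Or.inr ⟨h1, rfl⟩), right' p h1⟩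

end Pattern

/-! ### The stones of a pattern form a necklace -/

/-- There is no stone between two consecutive stones. -/
theorem Consecutive.exists_dist {n : ℕ} [NeZero n] {S : Config n} {s t : ZMod n × ℤ}
    (hS : ∀ s ∈ S, ∀ t ∈ S, s.1 = t.1 → s = t) (h : Consecutive S s t) :
    ∃ d, cwDist s.1 t.1 = d ∧ t.1 = s.1 + (d : ZMod n) ∧ 0 < d ∧
      ∀ e : ℕ, 0 < e → e < d → ∀ v, (s.1 + (e : ZMod n), v) ∉ S := by
  obtain ⟨hs, ht, hst, hmin⟩ := h
  refine ⟨_, rfl, ?_, ?_, fun e he hed v hv => ?_⟩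
  · rw [cwDist, ZMod.natCast_zmod_val, add_sub_cancel]
  · rw [cwDist, Nat.pos_iff_ne_zero, ne_eq, ZMod.val_eq_zero, sub_eq_zero]
    exact fun h => hst (hS s hs t ht h.symm)
  · have hen : e < n := hed.trans (ZMod.val_lt _)
    have hval : cwDist s.1 (s.1 + (e : ZMod n)) = e := by
      rw [cwDist, add_sub_cancel_left, ZMod.val_natCast_of_lt hen]
    have hne : (s.1 + (e : ZMod n), v) ≠ s := by
      intro h
      have h1 : s.1 + (e : ZMod n) = s.1 := congrArg Prod.fst h
      rw [h1, cwDist, sub_self, ZMod.val_zero] at hval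
      omega
    have := hmin _ hv hne
    simp only at this
    rw [hval] at this
    omega

namespace Pattern
variable {n : ℕ} {P Q : Pattern n}

theorem IsAdmissible.no_two_zeros' (h : P.IsAdmissible) (i : ZMod n) :
    P.row2 i = true ∨ P.row2 (i + 1) = true := by
  revert i
  refine forall_zmod_iff.2 fun i => ?_
  have := h.no_two_zeros i
  push_cast at this
  exact this

theorem IsAdmissible.three' (h : P.IsAdmissible) (i : ZMod n) (h0 : P.row2 i = false)
    (h4 : P.row2 (i + 4) = false) : P.row1 (i + 2) = false := by
  revert i
  refine forall_zmod_iff.2 fun i h0 h4 => ?_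
  have := h.three i
  push_cast at this
  exact this h0 h4

theorem IsAdmissible.next_zero' (h : P.IsAdmissible) (i : ZMod n) (h0 : P.row2 i = false) :
    P.row1 (i + 1) = false := by
  revert i
  refine forall_zmod_iff.2 fun i h0 => ?_
  have := h.next_zero i
  push_cast at this
  exact this h0

theorem IsAdmissible.prev_zero' (h : P.IsAdmissible) (i : ZMod n) (h0 : P.row2 (i + 1) = false) :
    P.row1 i = false := by
  revert i
  refine forall_zmod_iff.2 fun i h0 => ?_
  have := h.prev_zero i
  push_cast at this
  exact this h0

/-- Inside a block of the second row, the singletons above it alternate with zeros. -/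
theorem IsAdmissible.alternate (h : P.IsAdmissible) (hr : P.IsReduced) (i : ZMod n)
    (h0 : P.row2 i = true) (h1 : P.row2 (i + 1) = true) (h2 : P.row2 (i + 2) = true)
    (h3 : P.row2 (i + 3) = true) : P.row1 (i + 2) = !P.row1 (i + 1) := by
  have h4 : P.row1 (i + 1) = true ∨ P.row1 (i + 2) = true := by
    revert i
    refine forall_zmod_iff.2 fun i h0 h1 h2 h3 => ?_
    have := h.dense i
    push_cast at this
    exact this h0 h1 h2 h3
  have h5 := hr (i + 1)
  rw [add_assoc, one_add_one_eq_two] at h5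
  cases h6 : P.row1 (i + 1) <;> simp_all

theorem row2_of_no_rightEnd {p : ZMod n} {d : ℕ} (hp : P.leftEnd p = true)
    (hd : ∀ e : ℕ, 0 < e → e < d → P.rightEnd (p + (e : ZMod n)) = false) :
    ∀ e : ℕ, e < d → P.row2 (p + (e : ZMod n)) = true := by
  simp only [leftEnd, Bool.and_eq_true] at hp
  intro e
  induction e using Nat.strong_induction_on with
  | _ e ih =>
    intro he
    rcases e with _ | _ | e
    · simpa using hp.1.2
    · simpa using hp.2
    · have h1 := ih e (by omega) (by omega)
      have h2 := ih (e + 1) (by omega) (by omega)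
      have h3 := hd (e + 2) (by omega) he
      have e1 : p + ((e + 2 : ℕ) : ZMod n) - 2 = p + (e : ZMod n) := by push_cast; ring
      have e2 : p + ((e + 2 : ℕ) : ZMod n) - 1 = p + ((e + 1 : ℕ) : ZMod n) := by push_cast; ring
      rw [rightEnd, e1, e2, h1, h2, Bool.and_self, Bool.true_and, Bool.not_eq_false'] at h3
      exact h3

theorem IsAdmissible.row2_of_no_leftEnd (h : P.IsAdmissible) {p : ZMod n} {d : ℕ}
    (hp : P.rightEnd p = true)
    (hd : ∀ e : ℕ, 0 < e → e < d → P.leftEnd (p + (e : ZMod n)) = false) :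
    ∀ e : ℕ, e < d → P.row2 (p + (e : ZMod n)) = decide (Odd e) := by
  simp only [rightEnd, Bool.and_eq_true, Bool.not_eq_true'] at hp
  suffices hs : ∀ e : ℕ, e < d → P.row2 (p + (e : ZMod n)) = decide (Odd e) ∧
      (Odd e → P.row2 (p + (e : ZMod n) - 1) = false) from fun e he => (hs e he).1
  intro e
  induction e with
  | zero =>
    intro _
    refine ⟨by simpa using hp.2, fun h => absurd h (by decide)⟩
  | succ e ih =>
    intro he
    obtain ⟨h1, h1'⟩ := ih (by omega)
    have h2 := h.no_two_zeros' (p + (e : ZMod n))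
    have e1 : p + ((e + 1 : ℕ) : ZMod n) = p + (e : ZMod n) + 1 := by push_cast; ring
    by_cases ho : Odd e
    · have h3 := hd e ho.pos (by omega)
      have hne : ¬ Odd (e + 1) := Nat.not_odd_iff_even.2 ho.add_one
      simp only [ho, decide_true] at h1
      rw [leftEnd, h1, h1' ho, Bool.not_false, Bool.true_and, Bool.true_and] at h3
      rw [e1, decide_eq_false hne]
      exact ⟨h3, fun h => absurd h hne⟩
    · simp only [ho, decide_false] at h1
      rw [e1, decide_eq_true (Nat.not_odd_iff_even.1 ho).add_one, add_sub_cancel_right]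
      exact ⟨h2.resolve_left (by simp [h1]), fun _ => h1⟩

/-- Between two blocks of the second row zeros and singletons alternate. -/
theorem IsAdmissible.away (h : P.IsAdmissible) {p : ZMod n} {d : ℕ} (hd0 : 0 < d)
    (hp : P.rightEnd p = true) (hpd : P.leftEnd (p + (d : ZMod n)) = true)
    (hd : ∀ e : ℕ, 0 < e → e < d → P.leftEnd (p + (e : ZMod n)) = false) : Odd d := by
  have := h.row2_of_no_leftEnd hp hd (d - 1) (by omega)
  simp only [leftEnd, Bool.and_eq_true, Bool.not_eq_true'] at hpd
  rw [Nat.cast_sub hd0, Nat.cast_one, ← add_sub_assoc, hpd.1.1, eq_comm,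
    decide_eq_false_iff_not, Nat.not_odd_iff_even] at this
  have h1 := this.add_one
  rwa [show d - 1 + 1 = d by omega] at h1

/-- The stones at the two ends of a block of length `d` satisfy the conditions on facing stones. -/
theorem IsAdmissible.towards (h : P.IsAdmissible) (hr : P.IsReduced) {p : ZMod n} {d : ℕ}
    (hd0 : 0 < d) (hp : P.leftEnd p = true) (hpd : P.rightEnd (p + (d : ZMod n)) = true)
    (hd : ∀ e : ℕ, 0 < e → e < d → P.rightEnd (p + (e : ZMod n)) = false) :
    3 ≤ d ∧ Odd (d + (P.leftVec p).natAbs + (P.rightVec (p + (d : ZMod n))).natAbs) ∧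
      (d = 3 → P.leftVec p = 1 ∧ P.rightVec (p + (d : ZMod n)) = -1) := by
  have hone := row2_of_no_rightEnd hp hd
  have hp' := hp
  have hpd' := hpd
  simp only [leftEnd, rightEnd, Bool.and_eq_true, Bool.not_eq_true'] at hp' hpd'
  have hd3 : 3 ≤ d := by
    by_contra hd3
    obtain rfl | rfl : d = 1 ∨ d = 2 := by omega
    · have := hpd'.2
      rw [Nat.cast_one, hp'.2] at this
      exact absurd this (by decide)
    · have h1 := h.no_pair' (p - 1) hp'.1.1 (by
        rw [← hpd'.2]
        congr 1
        push_cast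
        ring) (by rw [sub_add_cancel]; exact hp'.1.2)
      have e : p - 1 + 2 = p + 1 := by ring
      rw [e, hp'.2] at h1
      exact absurd h1 (by decide)
  have three : d = 3 → P.leftVec p = 1 ∧ P.rightVec (p + (d : ZMod n)) = -1 := by
    rintro rfl
    have h1 := hpd'.2
    push_cast at h1
    have e : p + ((3 : ℕ) : ZMod n) - 4 = p - 1 := by push_cast; ring
    rw [leftVec, rightVec, e, h1, hp'.1.1]
    simp
  refine ⟨hd3, ?_, three⟩
  rcases hd3.eq_or_lt with rfl | hd4
  · obtain ⟨h1, h2⟩ := three rfl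
    rw [h1, h2]
    decide
  · -- the entries above the block alternate, from the second to the second to last position
    have alt : ∀ f : ℕ, f + 3 ≤ d →
        P.row1 (p + (f : ZMod n) + 1) = (P.row1 (p + 1) ^^ decide (Odd f)) := by
      intro f
      induction f with
      | zero => simp
      | succ f ih =>
        intro hf
        have h0 := hone f (by omega)
        have h1 := hone (f + 1) (by omega)
        have h2 := hone (f + 2) (by omega)
        have h3 := hone (f + 3) (by omega)
        push_cast at h1 h2 h3
        rw [← add_assoc] at h1 h2 h3
        have e1 : p + ((f + 1 : ℕ) : ZMod n) + 1 = p + (f : ZMod n) + 2 := by push_cast; ring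
        rw [e1, h.alternate hr _ h0 h1 h2 h3, ih (by omega)]
        by_cases ho : Odd f <;> simp [ho, Nat.odd_add_one]
    obtain ⟨f, rfl⟩ := Nat.exists_eq_add_of_le hd4
    have h1 := alt (f + 1) (by omega)
    have h2 := hone 3 (by omega)
    have h3 := hone f (by omega)
    push_cast at h2
    have e1 : p + ((3 + 1 + f : ℕ) : ZMod n) - 2 = p + ((f + 1 : ℕ) : ZMod n) + 1 := by
      push_cast; ring
    have e2 : p + ((3 + 1 + f : ℕ) : ZMod n) - 4 = p + (f : ZMod n) := by push_cast; ring
    rw [leftVec, rightVec, e1, e2, h1, h2, h3]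
    cases P.row1 (p + 1) <;> by_cases ho : Odd f <;> simp [ho, Nat.odd_add_one] <;> grind

variable [NeZero n]

theorem IsAdmissible.isNecklace_stones (h : P.IsAdmissible) (hr : P.IsReduced) :
    IsNecklace P.blocks n P.stones := by
  have hdist : ∀ s ∈ P.stones, ∀ t ∈ P.stones, s.1 = t.1 → s = t := by
    rintro ⟨i, v⟩ hs ⟨j, w⟩ ht hij
    simp only at hij
    subst hij
    rcases mem_stones.1 hs with ⟨h1, h2⟩ | ⟨h1, h2⟩ <;>
      rcases mem_stones.1 ht with ⟨h3, h4⟩ | ⟨h3, h4⟩ <;> simp only at h1 h2 h3 h4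
    · rw [h2, h4]
    · rw [not_leftEnd_and_rightEnd h1] at h3
      exact absurd h3 (by decide)
    · rw [not_leftEnd_and_rightEnd h3] at h1
      exact absurd h1 (by decide)
    · rw [h2, h4]
  have hL : ∀ {s : ZMod n × ℤ} {d : ℕ}, (∀ e : ℕ, 0 < e → e < d → ∀ v,
      (s.1 + (e : ZMod n), v) ∉ P.stones) → ∀ e : ℕ, 0 < e → e < d →
      P.leftEnd (s.1 + (e : ZMod n)) = false := by
    intro s d h e he hed
    by_contra h1
    exact h e he hed (P.leftVec _) (mem_stones.2 (Or.inl ⟨by simpa using h1, rfl⟩))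
  have hR : ∀ {s : ZMod n × ℤ} {d : ℕ}, (∀ e : ℕ, 0 < e → e < d → ∀ v,
      (s.1 + (e : ZMod n), v) ∉ P.stones) → ∀ e : ℕ, 0 < e → e < d →
      P.rightEnd (s.1 + (e : ZMod n)) = false := by
    intro s d h e he hed
    by_contra h1
    exact h e he hed (P.rightVec _) (mem_stones.2 (Or.inr ⟨by simpa using h1, rfl⟩))
  have htow : ∀ s t, Consecutive P.stones s t → 0 < s.2 → t.2 < 0 →
      3 ≤ cwDist s.1 t.1 ∧ Odd (cwDist s.1 t.1 + s.2.natAbs + t.2.natAbs) ∧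
      (cwDist s.1 t.1 = 3 → s.2 = 1 ∧ t.2 = -1) := by
    intro s t hst hs ht
    obtain ⟨d, hd, htd, hd0, hno⟩ := hst.exists_dist hdist
    obtain ⟨h1, h2⟩ := leftEnd_of_pos hst.1 hs
    obtain ⟨h3, h4⟩ := rightEnd_of_neg hst.2.1 ht
    rw [htd] at h3 h4
    rw [hd, h2, h4]
    exact h.towards hr hd0 h1 h3 (hR hno)
  refine ⟨card_stones hr, hdist, ?_, ?_, ?_, fun s t hst hs ht => (htow s t hst hs ht).2.1,
    fun s t hst hs ht => (htow s t hst hs ht).1, fun s t hst hs ht h3 => ?_⟩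
  · intro s hs
    rcases mem_stones.1 hs with ⟨-, h1⟩ | ⟨-, h1⟩
    · rw [h1, leftVec]
      split_ifs <;> simp
    · rw [h1, rightVec]
      split_ifs <;> simp
  · intro s t hst
    obtain ⟨d, hd, htd, hd0, hno⟩ := hst.exists_dist hdist
    rcases mem_stones.1 hst.1 with ⟨h1, h2⟩ | ⟨h1, h2⟩ <;>
      rcases mem_stones.1 hst.2.1 with ⟨h3, h4⟩ | ⟨h3, h4⟩ <;> rw [h2, h4]
    · exfalso
      have := row2_of_no_rightEnd h1 (hR hno) (d - 1) (by omega)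
      simp only [leftEnd, Bool.and_eq_true, Bool.not_eq_true'] at h3
      rw [Nat.cast_sub hd0, Nat.cast_one, ← add_sub_assoc, ← htd, h3.1.1] at this
      exact absurd this (by decide)
    · simp [leftVec_pos, rightVec_neg]
    · have e1 := P.leftVec_pos t.1
      have e2 := P.rightVec_neg s.1
      constructor <;> intro <;> omega
    · exfalso
      have h5 := h.row2_of_no_leftEnd h1 (hL hno)
      simp only [rightEnd, Bool.and_eq_true, Bool.not_eq_true'] at h1 h3
      obtain ⟨c, rfl⟩ := Nat.exists_eq_succ_of_ne_zero hd0.ne'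
      have h6 := h5 c (by omega)
      have e1 : t.1 - 1 = s.1 + (c : ZMod n) := by rw [htd]; push_cast; ring
      rw [← e1, h3.1.2, eq_comm, decide_eq_true_iff] at h6
      have h7 := h5 (c - 1) (by omega)
      have e2 : s.1 + ((c - 1 : ℕ) : ZMod n) = t.1 - 2 := by
        rw [htd, Nat.cast_sub h6.pos]
        push_cast
        ring
      rw [e2, h3.1.1, eq_comm, decide_eq_true_iff] at h7
      have h8 := h7.add_one
      rw [show c - 1 + 1 = c from Nat.sub_add_cancel h6.pos] at h8
      exact Nat.not_odd_iff_even.2 h8 h6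
  · intro s t hst hs ht
    obtain ⟨d, hd, htd, hd0, hno⟩ := hst.exists_dist hdist
    rw [hd]
    refine h.away hd0 (rightEnd_of_neg hst.1 hs).1 ?_ (hL hno)
    rw [← htd]
    exact (leftEnd_of_pos hst.2.1 ht).1
  · obtain ⟨h1, h2⟩ := (htow s t hst hs ht).2.2 h3
    rw [h1, h2]
    decide

end Pattern

/-! ### A reduced pattern is determined by its stones -/

namespace Pattern
variable {n : ℕ} [NeZero n] {P Q : Pattern n}

theorem leftEnd_iff_exists {i : ZMod n} :
    P.leftEnd i = true ↔ ∃ v, 0 < v ∧ (i, v) ∈ P.stones :=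
  ⟨fun h => ⟨_, P.leftVec_pos i, mem_stones.2 (Or.inl ⟨h, rfl⟩)⟩,
    fun ⟨_, h, hv⟩ => (leftEnd_of_pos hv h).1⟩

theorem rightEnd_iff_exists {i : ZMod n} :
    P.rightEnd i = true ↔ ∃ v, v < 0 ∧ (i, v) ∈ P.stones :=
  ⟨fun h => ⟨_, P.rightVec_neg i, mem_stones.2 (Or.inr ⟨h, rfl⟩)⟩,
    fun ⟨_, h, hv⟩ => (rightEnd_of_neg hv h).1⟩

theorem leftEnd_congr (h : P.stones = Q.stones) (i : ZMod n) : P.leftEnd i = Q.leftEnd i := by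
  rw [Bool.eq_iff_iff, leftEnd_iff_exists, leftEnd_iff_exists, h]

theorem rightEnd_congr (h : P.stones = Q.stones) (i : ZMod n) : P.rightEnd i = Q.rightEnd i := by
  rw [Bool.eq_iff_iff, rightEnd_iff_exists, rightEnd_iff_exists, h]

theorem leftVec_congr (h : P.stones = Q.stones) {i : ZMod n} (hi : P.leftEnd i = true) :
    P.leftVec i = Q.leftVec i := by
  have h1 : (i, P.leftVec i) ∈ P.stones := mem_stones.2 (Or.inl ⟨hi, rfl⟩)
  rw [h] at h1
  exact (leftEnd_of_pos h1 (P.leftVec_pos i)).2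

theorem IsReduced.exists_leftEnd (hr : P.IsReduced) (h : 0 < P.blocks) :
    ∃ p, P.leftEnd p = true := by
  rw [hr.blocks_eq, leftEnds] at h
  obtain ⟨i, -, hi⟩ := Finset.exists_ne_zero_of_sum_ne_zero h.ne'
  refine ⟨i + 1, ?_⟩
  rw [leftEnd, add_sub_cancel_right, add_assoc, one_add_one_eq_two]
  by_contra h1
  rw [Bool.not_eq_true] at h1
  rw [h1] at hi
  exact hi rfl

/-- Induction along the circle. -/
theorem forall_zmod {p : ZMod n → Prop} (a : ZMod n) (h0 : p a) (h1 : ∀ i, p i → p (i + 1))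
    (i : ZMod n) : p i := by
  obtain ⟨j, -, rfl⟩ := exists_eq_add_natCast a i
  induction j with
  | zero => simpa using h0
  | succ j ih =>
    have := h1 _ ih
    rwa [add_assoc, ← Nat.cast_succ] at this

/-- Starting at a left end, the second row is determined step by step by the ends of the blocks. -/
theorem row2_eq_of_stones_eq (hP : P.IsAdmissible) (hQ : Q.IsAdmissible)
    (h : P.stones = Q.stones) {p : ZMod n} (hp : P.leftEnd p = true) (i : ZMod n) :
    P.row2 i = Q.row2 i := by
  have hq := leftEnd_congr h p
  rw [hp, eq_comm] at hq
  simp only [leftEnd, Bool.and_eq_true, Bool.not_eq_true'] at hp hq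
  refine (forall_zmod (p := fun i => P.row2 i = Q.row2 i ∧ P.row2 (i + 1) = Q.row2 (i + 1)) p
    ⟨by rw [hp.1.2, hq.1.2], by rw [hp.2, hq.2]⟩ (fun i hi => ⟨hi.2, ?_⟩) i).1
  obtain ⟨h1, h2⟩ := hi
  have e : i + 1 + 1 = i + 2 := by ring
  have e1 : i + 2 - 2 = i := by ring
  have e2 : i + 2 - 1 = i + 1 := by ring
  have hR := rightEnd_congr h (i + 2)
  have hL := leftEnd_congr h (i + 1)
  rw [rightEnd, rightEnd, e1, e2, ← h1, ← h2] at hR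
  rw [leftEnd, leftEnd, add_sub_cancel_right, e, ← h1, ← h2] at hL
  rw [e]
  have hP2 := hP.no_two_zeros' (i + 1)
  have hQ2 := hQ.no_two_zeros' (i + 1)
  rw [e] at hP2 hQ2
  rw [← h2] at hQ2
  cases h3 : P.row2 i <;> cases h4 : P.row2 (i + 1) <;> simp_all

theorem eq_of_stones_eq (hP : P.IsAdmissible) (hPr : P.IsReduced) (hQ : Q.IsAdmissible)
    (hQr : Q.IsReduced) (h : P.stones = Q.stones) (hb : 0 < P.blocks) : P = Q := by
  obtain ⟨p, hp⟩ := hPr.exists_leftEnd hb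
  have h2 := row2_eq_of_stones_eq hP hQ h hp
  have hp' := hp
  simp only [leftEnd, Bool.and_eq_true, Bool.not_eq_true'] at hp'
  have h1 : ∀ i, P.row1 i = Q.row1 i := by
    refine forall_zmod p ?_ fun i hi => ?_
    · have e1 := hP.next_zero' (p - 1) hp'.1.1
      have e2 := hQ.next_zero' (p - 1) (by rw [← h2]; exact hp'.1.1)
      rw [sub_add_cancel] at e1 e2
      rw [e1, e2]
    · have e : i + 1 + 1 = i + 2 := by ring
      cases y0 : P.row2 i
      · rw [hP.next_zero' i y0, hQ.next_zero' i (by rw [← h2, y0])]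
      cases y2 : P.row2 (i + 2)
      · rw [hP.prev_zero' (i + 1) (by rw [e, y2]), hQ.prev_zero' (i + 1) (by rw [e, ← h2, y2])]
      cases y1 : P.row2 (i + 1)
      · cases x1 : P.row1 (i + 1)
        · cases x1' : Q.row1 (i + 1)
          · rfl
          · rw [h2, Q.below _ x1'] at y1
            exact absurd y1 (by decide)
        · rw [P.below _ x1] at y1
          exact absurd y1 (by decide)
      cases y3 : P.row2 (i - 1)
      · have hi' : P.leftEnd i = true := by rw [leftEnd, y3, y0, y1]; rfl
        have hv := leftVec_congr h hi'
        rw [leftVec, leftVec, ← h2] at hv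
        cases y4 : P.row2 (i + 3)
        · have e3 : i - 1 + 4 = i + 3 := by ring
          have e4 : i - 1 + 2 = i + 1 := by ring
          have := hP.three' (i - 1) y3 (by rw [e3, y4])
          have := hQ.three' (i - 1) (by rw [← h2, y3]) (by rw [e3, ← h2, y4])
          simp_all
        · rw [y4] at hv
          cases x1 : P.row1 (i + 1) <;> cases x1' : Q.row1 (i + 1) <;> simp_all
      · have e3 : i - 1 + 2 = i + 1 := by ring
        have e4 : i - 1 + 3 = i + 2 := by ring
        have e5 := hP.alternate hPr (i - 1) y3 (by rw [sub_add_cancel, y0]) (by rw [e3, y1])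
          (by rw [e4, y2])
        have e6 := hQ.alternate hQr (i - 1) (by rw [← h2, y3]) (by rw [sub_add_cancel, ← h2, y0])
          (by rw [e3, ← h2, y1]) (by rw [e4, ← h2, y2])
        rw [e3, sub_add_cancel] at e5 e6
        rw [e5, e6, hi]
  cases P
  cases Q
  simp only [mk.injEq]
  exact ⟨funext h1, funext h2⟩

end Pattern

/-! ### Isometries -/

theorem Admissible.shift {x y : ℤ → Bool} (h : Admissible x y) (c : ℤ) :
    Admissible (fun i => x (i + c)) fun i => y (i + c) := by
  constructor <;> intro i
  · exact h.le _
  · grind [h.no_two_zeros (i + c)]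
  · grind [h.no_pair (i + c)]
  · grind [h.three (i + c)]
  · grind [h.next_zero (i + c)]
  · grind [h.prev_zero (i + c)]
  · grind [h.left_end (i + c)]
  · grind [h.right_end (i + c)]
  · grind [h.dense (i + c)]
  · grind [h.no_pair_above (i + c)]
  · grind [h.no_four (i + c)]

theorem Admissible.reflect {x y : ℤ → Bool} (h : Admissible x y) (c : ℤ) :
    Admissible (fun i => x (c - i)) fun i => y (c - i) := by
  constructor <;> intro i
  · exact h.le _
  · grind [h.no_two_zeros (c - i - 1)]
  · grind [h.no_pair (c - i - 3)]
  · grind [h.three (c - i - 4)]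
  · grind [h.prev_zero (c - i - 1)]
  · grind [h.next_zero (c - i - 1)]
  · grind [h.right_end (c - i - 3)]
  · grind [h.left_end (c - i - 3)]
  · grind [h.dense (c - i - 3)]
  · grind [h.no_pair_above (c - i - 3)]
  · grind [h.no_four (c - i - 3)]

namespace Pattern
variable {n : ℕ} {P Q : Pattern n}

/-- The pattern rotated by `-c`. -/
def shift (P : Pattern n) (c : ZMod n) : Pattern n where
  row1 i := P.row1 (i + c)
  row2 i := P.row2 (i + c)
  below _ := P.below _

/-- The pattern reflected by `i ↦ c - i`. -/
def reflect (P : Pattern n) (c : ZMod n) : Pattern n where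
  row1 i := P.row1 (c - i)
  row2 i := P.row2 (c - i)
  below _ := P.below _

theorem IsAdmissible.shift (h : P.IsAdmissible) (c : ZMod n) : (P.shift c).IsAdmissible := by
  obtain ⟨c, rfl⟩ := ZMod.intCast_surjective c
  have := Admissible.shift h c
  push_cast at this
  exact this

theorem IsAdmissible.reflect (h : P.IsAdmissible) (c : ZMod n) : (P.reflect c).IsAdmissible := by
  obtain ⟨c, rfl⟩ := ZMod.intCast_surjective c
  have := Admissible.reflect h c
  push_cast at this
  exact this

theorem IsReduced.shift (h : P.IsReduced) (c : ZMod n) : (P.shift c).IsReduced := by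
  intro i hi
  have := h (i + c) hi
  rwa [add_right_comm] at this

theorem IsReduced.reflect (h : P.IsReduced) (c : ZMod n) : (P.reflect c).IsReduced := by
  intro i hi
  by_contra h1
  rw [Bool.not_eq_false] at h1
  have := h (c - (i + 1)) h1
  have e : c - (i + 1) + 1 = c - i := by ring
  rw [e] at this
  exact absurd (hi.symm.trans this) (by decide)

variable [NeZero n]

theorem stones_shift (P : Pattern n) (c : ZMod n) :
    (P.shift (-c)).stones = HardSquares.move 1 c P.stones := by
  ext ⟨i, v⟩
  have e : ∀ a : ZMod n, i + a + -c = i - c + a := fun a => by ring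
  have e' : ∀ a : ZMod n, i - a + -c = i - c - a := fun a => by ring
  have e0 : i + -c = i - c := by ring
  have h1 : (P.shift (-c)).leftEnd i = P.leftEnd (i - c) := by
    simp only [leftEnd, Pattern.shift, e, e', e0]
  have h2 : (P.shift (-c)).rightEnd i = P.rightEnd (i - c) := by
    simp only [rightEnd, Pattern.shift, e', e0]
  have h3 : (P.shift (-c)).leftVec i = P.leftVec (i - c) := by
    simp only [leftVec, Pattern.shift, e]
  have h4 : (P.shift (-c)).rightVec i = P.rightVec (i - c) := by
    simp only [rightVec, Pattern.shift, e']
  rw [mem_stones, h1, h2, h3, h4, ← mem_stones (s := (i - c, v)), HardSquares.move,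
    Finset.mem_image]
  constructor
  · exact fun h => ⟨_, h, by simp⟩
  · rintro ⟨s, hs, h⟩
    simp only [Units.val_one, Int.cast_one, one_mul, Prod.mk.injEq] at h
    rw [← h.1, ← h.2, add_sub_cancel_right]
    exact hs

/-- The reflection `i ↦ c - 1 - i` of the columns reflects the points between them by `i ↦ c - i`,
as the point `i` lies between the columns `i - 1` and `i`. -/
theorem stones_reflect (P : Pattern n) (c : ZMod n) :
    (P.reflect (c - 1)).stones = HardSquares.move (-1) c P.stones := by
  ext ⟨i, v⟩
  have h1 : (P.reflect (c - 1)).leftEnd i = P.rightEnd (c - i) := by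
    have e1 : c - 1 - (i - 1) = c - i := by ring
    have e2 : c - 1 - i = c - i - 1 := by ring
    have e3 : c - 1 - (i + 1) = c - i - 2 := by ring
    simp only [leftEnd, rightEnd, Pattern.reflect, e1, e2, e3]
    cases P.row2 (c - i) <;> cases P.row2 (c - i - 1) <;> cases P.row2 (c - i - 2) <;> rfl
  have h2 : (P.reflect (c - 1)).rightEnd i = P.leftEnd (c - i) := by
    have e1 : c - 1 - (i - 2) = c - i + 1 := by ring
    have e2 : c - 1 - (i - 1) = c - i := by ring
    have e3 : c - 1 - i = c - i - 1 := by ring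
    simp only [leftEnd, rightEnd, Pattern.reflect, e1, e2, e3]
    cases P.row2 (c - i) <;> cases P.row2 (c - i - 1) <;> cases P.row2 (c - i + 1) <;> rfl
  have h3 : (P.reflect (c - 1)).leftVec i = -P.rightVec (c - i) := by
    have e1 : c - 1 - (i + 1) = c - i - 2 := by ring
    have e2 : c - 1 - (i + 3) = c - i - 4 := by ring
    simp only [leftVec, rightVec, Pattern.reflect, e1, e2]
    split_ifs <;> rfl
  have h4 : (P.reflect (c - 1)).rightVec i = -P.leftVec (c - i) := by
    have e1 : c - 1 - (i - 2) = c - i + 1 := by ring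
    have e2 : c - 1 - (i - 4) = c - i + 3 := by ring
    simp only [leftVec, rightVec, Pattern.reflect, e1, e2]
    split_ifs <;> rfl
  have h5 : (i, v) ∈ (P.reflect (c - 1)).stones ↔ (c - i, -v) ∈ P.stones := by
    rw [mem_stones, mem_stones]
    simp only [h1, h2, h3, h4, eq_neg_iff_add_eq_zero, neg_eq_iff_add_eq_zero]
    tauto
  rw [h5, HardSquares.move, Finset.mem_image]
  constructor
  · exact fun h => ⟨_, h, by simp⟩
  · rintro ⟨s, hs, h⟩
    simp only [Units.val_neg, Units.val_one, Int.cast_neg, Int.cast_one, neg_mul, one_mul,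
      Prod.mk.injEq] at h
    have e : c - (-s.1 + c) = s.1 := by ring
    rw [← h.1, ← h.2, neg_neg, e]
    exact hs

theorem Z_shift (hn : Even n) (P : Pattern n) (c : ZMod n) (m : ℕ) : (P.shift c).Z m = P.Z m := by
  refine (Z_congr hn (Equiv.addRight c) ?_ (fun _ => rfl) (fun _ => rfl) m).symm
  intro i j
  simp only [Equiv.coe_addRight, add_right_comm _ c, add_left_inj]

theorem Z_reflect (hn : Even n) (P : Pattern n) (c : ZMod n) (m : ℕ) :
    (P.reflect c).Z m = P.Z m := by
  refine (Z_congr hn (Equiv.subLeft c) ?_ (fun _ => rfl) (fun _ => rfl) m).symm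
  intro i j
  simp only [Equiv.subLeft_apply]
  constructor
  · rintro (h | h)
    · right; linear_combination h
    · left; linear_combination h
  · rintro (rfl | rfl)
    · right; ring
    · left; ring

/-- Patterns with isometric stones have the same Witten indices. -/
theorem Z_eq_of_stones (hn : Even n) (hP : P.IsAdmissible) (hPr : P.IsReduced)
    (hQ : Q.IsAdmissible) (hQr : Q.IsReduced) (hb : 0 < Q.blocks) {ε : ℤˣ} {c : ZMod n}
    (h : Q.stones = HardSquares.move ε c P.stones) (m : ℕ) : Q.Z m = P.Z m := by
  rcases Int.units_eq_one_or ε with rfl | rfl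
  · rw [← stones_shift] at h
    rw [eq_of_stones_eq hQ hQr (hP.shift _) (hPr.shift _) h hb, Z_shift hn]
  · rw [← stones_reflect] at h
    rw [eq_of_stones_eq hQ hQr (hP.reflect _) (hPr.reflect _) h hb, Z_reflect hn]

end Pattern

/-! ### Power series with a prescribed denominator -/

/-- The polynomials with integer coefficients, as a subring of the power series. -/
noncomputable def intPoly : Subring (PowerSeries ℚ) :=
  ((Polynomial.coeToPowerSeries.ringHom (R := ℚ)).comp
    (Polynomial.mapRingHom (Int.castRingHom ℚ))).range

theorem mem_intPoly {F : PowerSeries ℚ} : F ∈ intPoly ↔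
    ∃ h : Polynomial ℤ, ((h.map (Int.castRingHom ℚ) : Polynomial ℚ) : PowerSeries ℚ) = F :=
  Iff.rfl

theorem X_mem_intPoly : (PowerSeries.X : PowerSeries ℚ) ∈ intPoly :=
  mem_intPoly.2 ⟨Polynomial.X, by simp⟩

theorem mem_intPoly_of_coeff {F : PowerSeries ℚ} (N : ℕ)
    (hz : ∀ m, ∃ z : ℤ, PowerSeries.coeff m F = z) (hN : ∀ m, N ≤ m → PowerSeries.coeff m F = 0) :
    F ∈ intPoly := by
  choose z hz using hz
  refine mem_intPoly.2 ⟨∑ i ∈ Finset.range N, Polynomial.monomial i (z i), ?_⟩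
  ext m
  rw [Polynomial.coeff_coe, Polynomial.coeff_map, Polynomial.finsetSum_coeff]
  simp only [Polynomial.coeff_monomial, Finset.sum_ite_eq', Finset.mem_range]
  split_ifs with h
  · rw [hz]
    rfl
  · rw [hN m (by omega)]
    rfl

/-- `F * (d 0 * ⋯ * d (k - 1))` is a polynomial with integer coefficients. -/
def HasDenom (d : ℕ → PowerSeries ℚ) (k : ℕ) (F : PowerSeries ℚ) : Prop :=
  F * ∏ i ∈ Finset.range k, d i ∈ intPoly

namespace HasDenom
variable {d : ℕ → PowerSeries ℚ} {k : ℕ} {F G p : PowerSeries ℚ}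

theorem add (hF : HasDenom d k F) (hG : HasDenom d k G) : HasDenom d k (F + G) := by
  unfold HasDenom
  rw [add_mul]
  exact add_mem hF hG

theorem mul_left (hp : p ∈ intPoly) (hF : HasDenom d k F) : HasDenom d k (p * F) := by
  unfold HasDenom
  rw [mul_assoc]
  exact mul_mem hp hF

theorem of_mem (hd : ∀ i, d i ∈ intPoly) (hF : F ∈ intPoly) : HasDenom d k F :=
  mul_mem hF (prod_mem fun i _ => hd i)

theorem succ (hd : ∀ i, d i ∈ intPoly) (hF : HasDenom d k F) : HasDenom d (k + 1) F := by
  unfold HasDenom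
  rw [Finset.prod_range_succ, ← mul_assoc]
  exact mul_mem hF (hd k)

theorem of_mul (hF : HasDenom d k (d k * F)) : HasDenom d (k + 1) F := by
  unfold HasDenom at *
  rw [Finset.prod_range_succ]
  convert hF using 1
  ring

/-- If `F` agrees with `± X ^ l * F` up to a series with the denominator `d 0 * ⋯ * d (k - 1)`, then
`(1 - X ^ (2 * g)) * F` has this denominator, for each multiple `g` of `l`: the factor `1 ∓ X ^ l`
divides `1 - X ^ (2 * l)`, which divides `1 - X ^ (2 * g)`. -/
theorem of_periodic {l g : ℕ} {s : ℤ}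
    (hs : s * s = 1) (hF : HasDenom d k (F - (s : PowerSeries ℚ) * (PowerSeries.X ^ l * F)))
    (hlg : l ∣ g) : HasDenom d k ((1 - PowerSeries.X ^ (2 * g)) * F) := by
  obtain ⟨q, rfl⟩ := hlg
  have hX := X_mem_intPoly
  have h1 : (1 + (s : PowerSeries ℚ) * PowerSeries.X ^ l) *
      ∑ i ∈ Finset.range q, (PowerSeries.X ^ (2 * l)) ^ i ∈ intPoly :=
    mul_mem (add_mem (one_mem _) (mul_mem (intCast_mem _ _) (pow_mem hX _)))
      (sum_mem fun i _ => pow_mem (pow_mem hX _) _)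
  have hs' : (s : PowerSeries ℚ) * s = 1 := by
    rw [← Int.cast_mul, hs, Int.cast_one]
  convert hF.mul_left h1 using 1
  rw [← mul_assoc 2, pow_mul _ (2 * l), ← mul_neg_geom_sum]
  generalize ∑ i ∈ Finset.range q, ((PowerSeries.X : PowerSeries ℚ) ^ (2 * l)) ^ i = S
  rw [two_mul, pow_add]
  linear_combination (S * PowerSeries.X ^ l * PowerSeries.X ^ l * F) * hs'

end HasDenom

/-! ### Generating functions of admissible patterns -/

namespace Pattern
variable {n : ℕ} {P Q : Pattern n}

/-- Blocks of the first row have length three. -/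
theorem IsAdmissible.centers_isolated (h : P.IsAdmissible) (c : ZMod n)
    (hc : P.centers c = true) : P.centers (c + 1) = false ∧ P.centers (c + 2) = false := by
  revert c
  refine forall_zmod_iff.2 fun c => ?_
  have := h.no_four (c - 1)
  have e : (c : ZMod n) + 2 - 1 = c + 1 := by ring
  have e1 : c - 1 + 2 = c + 1 := by ring
  have e2 : c - 1 + 3 = c + 2 := by ring
  rw [sub_add_cancel, e1, e2] at this
  push_cast at this
  simp only [centers, Bool.and_eq_true, add_sub_cancel_right, e]
  rintro ⟨⟨h1, h2⟩, h3⟩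
  have h4 := this h1 h2 h3
  have e3 : (c : ZMod n) + 1 + 1 = c + 2 := by ring
  rw [e3, h4]
  simp

theorem cut_cut (P : Pattern n) (δ ε : ZMod n → Bool) :
    (P.cut δ).cut ε = P.cut fun i => δ i || ε i := by
  simp only [cut, mk.injEq]
  constructor
  · funext i
    cases P.row1 i <;> cases δ (i - 1) <;> cases δ i <;> cases δ (i + 1) <;> simp
  · funext i
    cases P.row2 i <;> cases δ i <;> simp

theorem cut_false (P : Pattern n) : (P.cut fun _ => false) = P := by
  cases P
  simp [cut]

variable [NeZero n]

theorem coeff_genFun (P : Pattern n) (m : ℕ) :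
    PowerSeries.coeff m P.genFun = (P.Z m : ℚ) :=
  PowerSeries.coeff_mk _ _

theorem genFun_congr (h : ∀ m, P.Z m = Q.Z m) : P.genFun = Q.genFun := by
  ext m
  rw [coeff_genFun, coeff_genFun, h]

/-- The recurrence `Z_eq_sub` may fail for the constant coefficients only. -/
theorem genFun_sub_mem (hn : Even n) {c : ZMod n} (hc : P.row1 c = true) :
    P.genFun - ((P.erase fun i => decide (i = c)).genFun -
      (P.cut fun i => decide (i = c)).genFun) ∈ intPoly := by
  refine mem_intPoly_of_coeff 1 (fun m => ⟨P.Z m - ((P.erase fun i => decide (i = c)).Z m -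
      (P.cut fun i => decide (i = c)).Z m), ?_⟩) fun m hm => ?_
  · simp only [map_sub, coeff_genFun]
    push_cast
    rfl
  · obtain ⟨m, rfl⟩ := Nat.exists_eq_add_of_le' hm
    simp only [map_sub, coeff_genFun, Z_eq_sub hn hc]
    push_cast
    ring

/-- The recurrence `Z_slide` may fail for the first two coefficients only. -/
theorem genFun_slide_mem (hn : Even n) (hr : P.IsReduced) :
    P.genFun - (((-1) ^ (Finset.univ.filter fun i => P.row1 i = true).card : ℤ) :
      PowerSeries ℚ) * (PowerSeries.X * P.slide.genFun) ∈ intPoly := by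
  set s : ℤ := (-1) ^ (Finset.univ.filter fun i => P.row1 i = true).card with hs
  have hC : ((s : ℤ) : PowerSeries ℚ) = PowerSeries.C (s : ℚ) := by simp
  refine mem_intPoly_of_coeff 2 (fun m => ?_) fun m hm => ?_
  · rcases m with _ | m
    · refine ⟨P.Z 0, ?_⟩
      rw [map_sub, coeff_genFun, hC, PowerSeries.coeff_C_mul, PowerSeries.coeff_zero_X_mul]
      simp
    · refine ⟨P.Z (m + 1) - s * P.slide.Z m, ?_⟩
      rw [map_sub, coeff_genFun, hC, PowerSeries.coeff_C_mul, PowerSeries.coeff_succ_X_mul,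
        coeff_genFun]
      push_cast
      rfl
  · obtain ⟨m, rfl⟩ := Nat.exists_eq_add_of_le' hm
    rw [map_sub, coeff_genFun, hC, PowerSeries.coeff_C_mul, PowerSeries.coeff_succ_X_mul,
      coeff_genFun, Z_slide hn hr, ← hs]
    push_cast
    ring

variable {d : ℕ → PowerSeries ℚ} {k : ℕ}

/-- Up to a sign and to patterns with fewer blocks, all blocks of the first row can be cut. -/
theorem IsAdmissible.genFun_cut_centers (hn : Even n) (hd : ∀ i, d i ∈ intPoly)
    (h : P.IsAdmissible) (hk : P.blocks = k)
    (ih : ∀ Q : Pattern n, Q.IsAdmissible → Q.blocks + 1 = k → HasDenom d k Q.genFun) :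
    ∃ s : ℤ, s * s = 1 ∧ HasDenom d k (P.genFun - s * (P.cut P.centers).genFun) := by
  classical
  have key : ∀ D : Finset (ZMod n), (∀ i ∈ D, P.centers i = true) → ∃ s : ℤ, s * s = 1 ∧
      HasDenom d k (P.genFun - s * (P.cut fun i => decide (i ∈ D)).genFun) := by
    intro D
    induction D using Finset.induction_on with
    | empty =>
      intro _
      refine ⟨1, rfl, ?_⟩
      simp only [Finset.notMem_empty, decide_false, cut_false, Int.cast_one, one_mul, sub_self]
      exact HasDenom.of_mem hd (zero_mem _)
    | insert c D hcD ihD =>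
      intro hD
      obtain ⟨s, hs, hs'⟩ := ihD fun i hi => hD i (Finset.mem_insert_of_mem hi)
      have hc := hD c (Finset.mem_insert_self _ _)
      have hDc : ∀ i, decide (i ∈ D) = true → P.centers i = true := fun i hi =>
        hD i (Finset.mem_insert_of_mem (of_decide_eq_true hi))
      set R := P.cut fun i => decide (i ∈ D) with hR
      have hRadm : R.IsAdmissible := h.cut hDc
      have hRb : R.blocks = k := by rw [hR, h.blocks_cut hDc, hk]
      -- `c` is far from the positions that have been cut already
      have far : c + 1 ∉ D ∧ c + 2 ∉ D ∧ c - 1 ∉ D ∧ c - 2 ∉ D := by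
        have h1 := h.centers_isolated c hc
        refine ⟨fun h2 => ?_, fun h2 => ?_, fun h2 => ?_, fun h2 => ?_⟩
        · have := hD _ (Finset.mem_insert_of_mem h2)
          simp_all
        · have := hD _ (Finset.mem_insert_of_mem h2)
          simp_all
        · have := (h.centers_isolated _ (hD _ (Finset.mem_insert_of_mem h2))).1
          rw [sub_add_cancel, hc] at this
          exact absurd this (by decide)
        · have := (h.centers_isolated _ (hD _ (Finset.mem_insert_of_mem h2))).2
          rw [sub_add_cancel, hc] at this
          exact absurd this (by decide)
      obtain ⟨f1, f2, f3, f4⟩ := far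
      have hRc : ∀ i, decide (i = c) = true → R.centers i = true := by
        intro i hi
        obtain rfl := of_decide_eq_true hi
        have e1 : i - 1 - 1 = i - 2 := by ring
        have e2 : i + 1 + 1 = i + 2 := by ring
        obtain ⟨⟨g1, g2⟩, g3⟩ : (P.row1 (i - 1) = true ∧ P.row1 i = true) ∧
            P.row1 (i + 1) = true := by simpa only [centers, Bool.and_eq_true] using hc
        simp [hR, centers, Pattern.cut, e1, e2, g1, g2, g3, f1, f2, f3, f4, hcD]
      have hsum : ∑ i : ZMod n, (decide (i = c)).toNat = 1 := by
        rw [Finset.sum_eq_single c] <;> simp +contextual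
      have hE : HasDenom d k (R.erase fun i => decide (i = c)).genFun := by
        refine ih _ (hRadm.erase hRc) ?_
        have := hRadm.blocks_erase hRc
        omega
      have hRrow : R.row1 c = true := by
        have := hRc c (by simp)
        simp only [centers, Bool.and_eq_true] at this
        exact this.1.2
      have hcut : (R.cut fun i => decide (i = c)) =
          P.cut fun i => decide (i ∈ insert c D) := by
        rw [hR, cut_cut]
        congr 1
        funext i
        simp [Bool.or_comm]
      have h3 := HasDenom.of_mem (k := k) hd (genFun_sub_mem hn hRrow)
      rw [hcut] at h3
      have hsm : ((s : ℤ) : PowerSeries ℚ) ∈ intPoly := intCast_mem _ _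
      refine ⟨-s, by rw [neg_mul_neg, hs], ?_⟩
      convert hs'.add ((h3.add hE).mul_left hsm) using 1
      push_cast
      ring
  obtain ⟨s, hs, hs'⟩ := key (Finset.univ.filter fun i => P.centers i = true) (by simp)
  refine ⟨s, hs, ?_⟩
  have e : (fun i => decide (i ∈ Finset.univ.filter fun i => P.centers i = true)) = P.centers := by
    funext i
    simp
  rwa [e] at hs'

/-- Up to a sign and to patterns with fewer blocks, passing to the next pattern divides by `X`. -/
theorem IsAdmissible.genFun_next (hn : Even n) (hd : ∀ i, d i ∈ intPoly)
    (h : P.IsAdmissible) (hr : P.IsReduced) (hk : P.blocks = k)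
    (ih : ∀ Q : Pattern n, Q.IsAdmissible → Q.blocks + 1 = k → HasDenom d k Q.genFun) :
    ∃ s : ℤ, s * s = 1 ∧
      HasDenom d k (P.genFun - ((s : ℤ) : PowerSeries ℚ) * (PowerSeries.X * P.next.genFun)) := by
  obtain ⟨s, hs, hs'⟩ := (h.slide hr).genFun_cut_centers hn hd (h.blocks_slide hr ▸ hk) ih
  have h1 := HasDenom.of_mem (k := k) hd (genFun_slide_mem hn hr)
  set e : ℤ := (-1) ^ (Finset.univ.filter fun i => P.row1 i = true).card with he
  have hee : e * e = 1 := by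
    rw [he, ← mul_pow]
    norm_num
  refine ⟨e * s, by rw [mul_mul_mul_comm, hee, hs, one_mul], ?_⟩
  have hm : ((e : ℤ) : PowerSeries ℚ) * PowerSeries.X ∈ intPoly :=
    mul_mem (intCast_mem _ _) X_mem_intPoly
  convert h1.add (hs'.mul_left hm) using 1
  rw [Pattern.next]
  push_cast
  ring

theorem IsAdmissible.iterate_next (h : P.IsAdmissible) (hr : P.IsReduced) (j : ℕ) :
    (Pattern.next^[j] P).IsAdmissible ∧ (Pattern.next^[j] P).IsReduced ∧
      (Pattern.next^[j] P).blocks = P.blocks := by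
  induction j with
  | zero => exact ⟨h, hr, rfl⟩
  | succ j ih =>
    rw [Function.iterate_succ_apply']
    exact ⟨ih.1.next ih.2.1, ih.1.isReduced_next ih.2.1, (ih.1.blocks_next ih.2.1).trans ih.2.2⟩

theorem IsAdmissible.genFun_iterate (hn : Even n) (hd : ∀ i, d i ∈ intPoly)
    (h : P.IsAdmissible) (hr : P.IsReduced) (hk : P.blocks = k)
    (ih : ∀ Q : Pattern n, Q.IsAdmissible → Q.blocks + 1 = k → HasDenom d k Q.genFun) (j : ℕ) :
    ∃ s : ℤ, s * s = 1 ∧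
      HasDenom d k (P.genFun - ((s : ℤ) : PowerSeries ℚ) *
        (PowerSeries.X ^ j * (Pattern.next^[j] P).genFun)) := by
  induction j with
  | zero =>
    refine ⟨1, rfl, ?_⟩
    simp only [Function.iterate_zero, id, pow_zero, one_mul, Int.cast_one, sub_self]
    exact HasDenom.of_mem hd (zero_mem _)
  | succ j ihj =>
    obtain ⟨s, hs, hs'⟩ := ihj
    obtain ⟨h1, h2, h3⟩ := h.iterate_next hr j
    obtain ⟨t, ht, ht'⟩ := h1.genFun_next hn hd h2 (h3.trans hk) ih
    refine ⟨s * t, by rw [mul_mul_mul_comm, hs, ht, one_mul], ?_⟩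
    have hm : ((s : ℤ) : PowerSeries ℚ) * PowerSeries.X ^ j ∈ intPoly :=
      mul_mem (intCast_mem _ _) (pow_mem X_mem_intPoly j)
    convert hs'.add (ht'.mul_left hm) using 1
    rw [Function.iterate_succ_apply']
    push_cast
    ring

end Pattern

/-! ### Patterns without blocks -/

namespace Pattern
variable {n : ℕ} {P : Pattern n}

theorem ext_rows {Q : Pattern n} (h1 : P.row1 = Q.row1) (h2 : P.row2 = Q.row2) : P = Q := by
  cases P
  cases Q
  simp_all

variable [NeZero n]

theorem card_filter_eq_sum (P : Pattern n) :
    (Finset.univ.filter fun i => P.row1 i = true).card = ∑ i, (P.row1 i).toNat := by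
  rw [Finset.card_filter]
  refine Finset.sum_congr rfl fun i _ => ?_
  cases P.row1 i <;> rfl

theorem sum_toNat_of_alternating {r : ZMod n → Bool} (h : ∀ i, r (i + 1) = !r i) :
    ∑ i, (r i).toNat = n / 2 := by
  have h1 : ∑ i, ((r (i + 1)).toNat + (r i).toNat) = n := by
    calc _ = ∑ _i : ZMod n, 1 := Finset.sum_congr rfl fun i _ => by rw [h]; cases r i <;> rfl
      _ = n := by simp [ZMod.card]
  rw [Finset.sum_add_distrib, sum_toNat_shift] at h1
  omega

/-- In a reduced admissible pattern without blocks one row alternates; the other one consists of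
ones if it is the second row, and of zeros if it is the first row. -/
theorem IsAdmissible.alternating_of_blocks_eq_zero (h : P.IsAdmissible) (hr : P.IsReduced)
    (hb : P.blocks = 0) :
    ((∀ i, P.row1 (i + 1) = !P.row1 i) ∧ ∀ i, P.row2 i = true) ∨
      ((∀ i, P.row2 (i + 1) = !P.row2 i) ∧ ∀ i, P.row1 i = false) := by
  by_cases hall : ∀ i, P.row2 i = true
  · refine Or.inl ⟨fun i => ?_, hall⟩
    have := h.alternate hr (i - 1) (hall _) (hall _) (hall _) (hall _)
    have e : i - 1 + 2 = i + 1 := by ring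
    rwa [e, sub_add_cancel] at this
  · push Not at hall
    obtain ⟨a, ha⟩ := hall
    replace ha : P.row2 a = false := by simpa using ha
    have h0 : ∀ i, P.row2 i = false → P.row2 (i + 1) = true := fun i hi => by
      simpa [hi] using h.no_two_zeros' i
    have hend : ∀ i, (!P.row2 i && P.row2 (i + 1) && P.row2 (i + 2)) = false := by
      intro i
      have h1 : leftEnds P.row2 = 0 := by
        unfold blocks at hb
        omega
      have h2 := (Finset.sum_eq_zero_iff.1 h1) i (Finset.mem_univ i)
      simpa using h2
    have halt : ∀ i, P.row2 (i + 1) = !P.row2 i := by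
      refine forall_zmod a (by rw [ha, h0 a ha]; rfl) fun i hi => ?_
      have e : i + 1 + 1 = i + 2 := by ring
      cases hc : P.row2 i
      · have h1 := hend i
        rw [hc, Bool.not_false] at hi
        rw [e, hi]
        simpa [hc, hi] using h1
      · rw [hc, Bool.not_true] at hi
        rw [h0 _ hi, hi, Bool.not_false]
    refine Or.inr ⟨halt, fun i => ?_⟩
    cases hc : P.row2 i
    · by_contra h1
      rw [Bool.not_eq_false] at h1
      simp [P.below i h1] at hc
    · exact h.prev_zero' i (by rw [halt, hc, Bool.not_true])

theorem IsAdmissible.genFun_mem_of_blocks_eq_zero (hn : Even n) (h : P.IsAdmissible)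
    (hr : P.IsReduced) (hb : P.blocks = 0) :
    P.genFun * (1 - (-1) ^ (n / 2) * PowerSeries.X ^ 2) ∈ intPoly := by
  -- folding twice rotates the pattern by one step
  have key : P.slide.IsReduced ∧ P.slide.slide = P.shift 1 ∧
      ∑ i, (P.row1 i).toNat + ∑ i, (P.slide.row1 i).toNat = n / 2 := by
    rcases h.alternating_of_blocks_eq_zero hr hb with ⟨halt, hone⟩ | ⟨halt, hzero⟩
    · have hs : ∀ i, P.slide.row1 i = false := by
        intro i
        have h1 := halt (i - 1)
        rw [sub_add_cancel] at h1
        simp only [Pattern.slide, h1]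
        cases P.row1 (i - 1) <;> simp
      refine ⟨fun i _ => hs _, ?_, ?_⟩
      · have e1 : P.slide.slide.row1 = (P.shift 1).row1 := by
          funext i
          show (P.slide.row2 i && !P.slide.row1 (i - 1) && !P.slide.row1 i &&
            !P.slide.row1 (i + 1)) = P.row1 (i + 1)
          rw [hs, hs, hs, halt]
          simp [Pattern.slide]
        have e2 : P.slide.slide.row2 = (P.shift 1).row2 := by
          funext i
          show (!P.slide.row1 i) = P.row2 (i + 1)
          simp [hs, hone]
        exact ext_rows e1 e2
      · simp only [hs, sum_toNat_of_alternating halt]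
        simp
    · have hs : ∀ i, P.slide.row1 i = P.row2 i := by
        intro i
        simp [Pattern.slide, hzero]
      refine ⟨fun i hi => ?_, ?_, ?_⟩
      · rw [hs] at hi ⊢
        rw [halt, hi, Bool.not_true]
      · have e1 : P.slide.slide.row1 = (P.shift 1).row1 := by
          funext i
          show (P.slide.row2 i && !P.slide.row1 (i - 1) && !P.slide.row1 i &&
            !P.slide.row1 (i + 1)) = P.row1 (i + 1)
          rw [hs, hs, hs, halt i, hzero]
          cases P.row2 i <;> simp
        have e2 : P.slide.slide.row2 = (P.shift 1).row2 := by
          funext i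
          show (!P.slide.row1 i) = P.row2 (i + 1)
          rw [hs, halt]
        exact ext_rows e1 e2
      · simp only [hs, hzero, sum_toNat_of_alternating halt]
        simp
  obtain ⟨hr', hs, hc⟩ := key
  have h1 := genFun_slide_mem hn hr
  have h2 := genFun_slide_mem hn hr'
  rw [hs, genFun_congr (Z_shift hn P 1), card_filter_eq_sum] at h2
  rw [card_filter_eq_sum] at h1
  rw [← hc]
  set a := ∑ i, (P.row1 i).toNat
  have hm : (((-1) ^ a : ℤ) : PowerSeries ℚ) * PowerSeries.X ∈ intPoly :=
    mul_mem (intCast_mem _ _) X_mem_intPoly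
  convert add_mem h1 (mul_mem hm h2) using 1
  push_cast
  ring

/-! ### Periodicity along the cycles of the necklace graph -/

instance : Finite (Pattern n) := by
  refine Finite.of_injective (fun P : Pattern n => (P.row1, P.row2)) fun P Q h => ?_
  cases P
  cases Q
  simpa using h

/-- The necklace of the `j`-th pattern that follows a reduced admissible pattern. -/
noncomputable def necklace (h : P.IsAdmissible) (hr : P.IsReduced) (j : ℕ) :
    Necklace P.blocks n :=
  ⟨(Pattern.next^[j] P).stones, by
    have := (h.iterate_next hr j).1.isNecklace_stones (h.iterate_next hr j).2.1
    rwa [(h.iterate_next hr j).2.2] at this⟩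

/-- Sooner or later, the necklaces of the iterates of a pattern run through a cycle. -/
theorem IsAdmissible.exists_cycle (hn : Even n) (h : P.IsAdmissible) (hr : P.IsReduced) :
    ∃ a l, IsCycleLength (neckGraph P.blocks n) l ∧
      ∃ (ε : ℤˣ) (c : ZMod n), (Pattern.next^[a + l] P).stones =
        HardSquares.move ε c (Pattern.next^[a] P).stones := by
  let c : ℕ → NecklaceClass P.blocks n := fun j => Quotient.mk _ (necklace h hr j)
  have hex : ∃ l, 1 ≤ l ∧ ∃ a, c (a + l) = c a := by
    obtain ⟨i, j, hij, he⟩ := Finite.exists_ne_map_eq_of_infinite fun j => Pattern.next^[j] P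
    have hc : c i = c j := by
      refine congrArg (Quotient.mk _) (Subtype.ext ?_)
      exact congrArg Pattern.stones he
    rcases hij.lt_or_gt with hlt | hlt
    · exact ⟨j - i, by omega, i, by rw [Nat.add_sub_cancel' hlt.le, hc]⟩
    · exact ⟨i - j, by omega, j, by rw [Nat.add_sub_cancel' hlt.le, hc]⟩
  classical
  obtain ⟨hl, a, ha⟩ := Nat.find_spec hex
  have hmin : ∀ m, m < Nat.find hex → 1 ≤ m → ∀ b, c (b + m) ≠ c b := fun m hm h1 b hb =>
    Nat.find_min hex hm ⟨h1, b, hb⟩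
  set l := Nat.find hex
  refine ⟨a, l, ⟨hl, fun i => c (a + i), fun i _ => ?_, ha, fun i hi j hj hij => ?_⟩, ?_⟩
  · refine ⟨necklace h hr (a + i), necklace h hr (a + (i + 1)), rfl, rfl, ?_⟩
    obtain ⟨h1, h2, -⟩ := h.iterate_next hr (a + i)
    show (Pattern.next^[a + i + 1] P).stones = transform (Pattern.next^[a + i] P).stones
    rw [h1.transform_stones hn h2, Function.iterate_succ_apply']
  · simp only [Set.mem_Iio] at hi hj
    by_contra hne
    rcases Ne.lt_or_gt hne with hlt | hlt
    · refine hmin (j - i) (by omega) (by omega) (a + i) ?_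
      rw [add_assoc, Nat.add_sub_cancel' hlt.le]
      exact hij.symm
    · refine hmin (i - j) (by omega) (by omega) (a + j) ?_
      rw [add_assoc, Nat.add_sub_cancel' hlt.le]
      exact hij
  · exact Quotient.exact ha.symm

/-! ### The denominator of the generating function -/

/-- The factors of the denominator: the factor with index `0` comes from the patterns without
blocks, and the one with index `i > 0` from the cycles of `(i, n)`-necklaces. -/
noncomputable def denom (n : ℕ) (g : ℕ → ℕ) (i : ℕ) : PowerSeries ℚ :=
  if i = 0 then 1 - (-1) ^ (n / 2) * PowerSeries.X ^ 2 else 1 - PowerSeries.X ^ (2 * g i)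

theorem denom_mem_intPoly (n : ℕ) (g : ℕ → ℕ) (i : ℕ) : denom n g i ∈ intPoly := by
  unfold denom
  split_ifs
  · exact sub_mem (one_mem _) (mul_mem (pow_mem (neg_mem (one_mem _)) _) (pow_mem X_mem_intPoly _))
  · exact sub_mem (one_mem _) (pow_mem X_mem_intPoly _)

theorem IsAdmissible.hasDenom_genFun (hn : Even n) {g : ℕ → ℕ} (k : ℕ)
    (hg : ∀ i, 1 ≤ i → i ≤ k → ∀ l, IsCycleLength (neckGraph i n) l → l ∣ g i)
    (P : Pattern n) (h : P.IsAdmissible) (hk : P.blocks = k) :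
    HasDenom (denom n g) (k + 1) P.genFun := by
  have hd := denom_mem_intPoly n g
  induction k generalizing P with
  | zero =>
    obtain ⟨s, -, hs⟩ := h.genFun_cut_centers hn hd hk fun Q _ hQ => by omega
    have hadm := h.cut (δ := P.centers) fun _ => id
    have h0 : HasDenom (denom n g) 1 (P.cut P.centers).genFun := by
      have := hadm.genFun_mem_of_blocks_eq_zero hn h.isReduced_cut
        ((h.blocks_cut fun _ => id).trans hk)
      simpa [HasDenom, denom] using this
    convert (hs.succ hd).add (h0.mul_left (intCast_mem intPoly s)) using 1
    ring
  | succ k ihk =>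
    have ih : ∀ Q : Pattern n, Q.IsAdmissible → Q.blocks + 1 = k + 1 →
        HasDenom (denom n g) (k + 1) Q.genFun := fun Q hQ hQk =>
      ihk (fun i h1 h2 => hg i h1 (by omega)) Q hQ (by omega)
    obtain ⟨s, -, hs⟩ := h.genFun_cut_centers hn hd hk ih
    have hadm := h.cut (δ := P.centers) fun _ => id
    have hred := h.isReduced_cut
    have hb := (h.blocks_cut (δ := P.centers) fun _ => id).trans hk
    generalize P.cut P.centers = R at hs hadm hred hb
    obtain ⟨a, l, hl, ε, c, hc⟩ := hadm.exists_cycle hn hred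
    rw [hb] at hl
    obtain ⟨b1, b2, b3⟩ := hadm.iterate_next hred a
    obtain ⟨c1, c2, c3⟩ := hadm.iterate_next hred (a + l)
    -- the `a`-th pattern lies on the cycle
    have hQ : HasDenom (denom n g) (k + 1 + 1) (Pattern.next^[a] R).genFun := by
      refine HasDenom.of_mul ?_
      obtain ⟨t, ht, hper⟩ := b1.genFun_iterate hn hd b2 (b3.trans hb) ih l
      rw [← Function.iterate_add_apply, add_comm l a,
        genFun_congr (Z_eq_of_stones hn b1 b2 c1 c2 (by omega) hc)] at hper
      have := HasDenom.of_periodic ht hper (hg (k + 1) (by omega) le_rfl l hl)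
      simpa [denom] using this
    obtain ⟨t, -, ht⟩ := hadm.genFun_iterate hn hd hred hb ih a
    have hX : ((s : PowerSeries ℚ) * (t : PowerSeries ℚ)) * PowerSeries.X ^ a ∈ intPoly :=
      mul_mem (mul_mem (intCast_mem _ _) (intCast_mem _ _)) (pow_mem X_mem_intPoly a)
    convert ((hs.succ hd).add ((ht.succ hd).mul_left (intCast_mem intPoly s))).add
      (hQ.mul_left hX) using 1
    ring

end Pattern

end HardSquares

theorem mainTheorem4 (n : ℕ) [NeZero n] (hn : Even n)
    (P : HardSquares.Pattern n) (hP : P.IsProper) (k : ℕ) (hk : P.mu = k)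
    (g : ℕ → ℕ)
    (hg : ∀ i ∈ Finset.Icc 1 k, 0 < g i ∧
      ∀ l : ℕ, HardSquares.IsCycleLength (HardSquares.neckGraph i n) l → l ∣ g i) :
    ∃ h : Polynomial ℤ,
      P.genFun =
        ((h.map (Int.castRingHom ℚ) : Polynomial ℚ) : PowerSeries ℚ) *
          (1 - (-1) ^ (n / 2) * PowerSeries.X ^ 2)⁻¹ *
          ∏ i ∈ Finset.Icc 1 k, (1 - PowerSeries.X ^ (2 * g i))⁻¹ := by
  obtain ⟨hadm, hmu⟩ := hP.isAdmissible_and_mu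
  have hF := hadm.hasDenom_genFun hn (g := g) k
    (fun i h1 h2 => (hg i (Finset.mem_Icc.2 ⟨h1, h2⟩)).2) P (hmu.symm.trans hk)
  obtain ⟨h, hh⟩ := HardSquares.mem_intPoly.1 hF
  refine ⟨h, ?_⟩
  have e : ∏ i ∈ Finset.range (k + 1), HardSquares.Pattern.denom n g i =
      (1 - (-1) ^ (n / 2) * PowerSeries.X ^ 2) *
        ∏ i ∈ Finset.Icc 1 k, (1 - PowerSeries.X ^ (2 * g i)) := by
    rw [Finset.prod_range_succ', mul_comm, Finset.range_eq_Ico, Finset.prod_Ico_add',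
      ← Finset.Ico_add_one_right_eq_Icc]
    congr 1
    refine Finset.prod_congr rfl fun i hi => ?_
    have := (Finset.mem_Ico.1 hi).1
    exact if_neg (by omega)
  have h0 : (1 - (-1) ^ (n / 2) * PowerSeries.X ^ 2 : PowerSeries ℚ) *
      (1 - (-1) ^ (n / 2) * PowerSeries.X ^ 2)⁻¹ = 1 :=
    PowerSeries.mul_inv_cancel _ (by simp)
  have h1 : (∏ i ∈ Finset.Icc 1 k, (1 - PowerSeries.X ^ (2 * g i) : PowerSeries ℚ)) *
      ∏ i ∈ Finset.Icc 1 k, (1 - PowerSeries.X ^ (2 * g i))⁻¹ = 1 := by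
    rw [← Finset.prod_mul_distrib]
    refine Finset.prod_eq_one fun i hi => PowerSeries.mul_inv_cancel _ ?_
    have := (hg i hi).1
    simp [show g i ≠ 0 by omega]
  rw [hh, e]
  linear_combination (-P.genFun) * h0 - P.genFun * ((1 - (-1) ^ (n / 2) * PowerSeries.X ^ 2) *
    (1 - (-1) ^ (n / 2) * PowerSeries.X ^ 2)⁻¹) * h1
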